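/- Let $\mathcal D\subset\mathbb R^d$ be finite and nonempty, let $\mathcal U$ be a finite family of (possibly overlapping) subsets $\mathcal I\subseteq\{1,\dots,d\}$, and write $\mathbf x^{\mathcal I}$ for the components of $\mathbf x$ with index in $\mathcal I$. Let $f(\mathbf x)=\sum_{\mathcal I\in\mathcal U}f_{\mathcal I}(\mathbf x^{\mathcal I})$, where the $f_{\mathcal I}$ are independent Gaussian processes with mean $0$ and covariance functions $\sigma_0^{\mathcal I}$ satisfying $\sigma_0^{\mathcal I}(\mathbf x^{\mathcal I},\mathbf x^{\mathcal I})\le\sigma_s^2$ on $\mathcal D$, with $\sigma_s>0$. Evaluating $f$ at the query $\mathbf x_t$ yields $y_t=f(\mathbf x_t)+\epsilon_t$, where $\epsilon_1,\epsilon_2,\dots$ are i.i.d. $\mathcal N(0,\sigma_n^2)$, $\sigma_n>0$, independent of the $f_{\mathcal I}$. Put $\sigma_0=\sum_{\mathcal I\in\mathcal U}\sigma_0^{\mathcal I}$ and, for queries $\mathbf x_1,\dots,\mathbf x_t$, let $$\mu_t^{\mathcal I}(\mathbf x^{\mathcal I})=\mathbf k^\top(\mathbf K+\sigma_n^2\mathbf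 1)^{-1}\mathbf y,\qquad \sigma_t^{\mathcal I}(\mathbf x^{\mathcal I})^2=\sigma_0^{\mathcal I}(\mathbf x^{\mathcal I},\mathbf x^{\mathcal I})-\mathbf k^\top(\mathbf K+\sigma_n^2\mathbf 1)^{-1}\mathbf k,$$ $$\widehat\sigma_t^{\mathcal I}(\mathbf x^{\mathcal I})^2=\sigma_0^{\mathcal I}(\mathbf x^{\mathcal I},\mathbf x^{\mathcal I})-\mathbf k^\top(\mathbf K^{\mathcal I}+\sigma_n^2\mathbf 1)^{-1}\mathbf k,$$ where $\mathbf y=(y_i)_{i\le t}$, $\mathbf k=(\sigma_0^{\mathcal I}(\mathbf x^{\mathcal I},\mathbf x_i^{\mathcal I}))_{i\le t}$, $\mathbf K=(\sigma_0(\mathbf x_i,\mathbf x_j))_{i,j\le t}$ and $\mathbf K^{\mathcal I}=(\sigma_0^{\mathcal I}(\mathbf x_i^{\mathcal I},\mathbf x_j^{\mathcal I}))_{i,j\le t}$; so $\widehat\sigma_t^{\mathcal I}$ is the posterior standard deviation given noisy outputs of $f_{\mathcal I}$ itself. Let $\delta\in(0,1)$ and $\beta_t=2\log(|\mathcal D||\mathcal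 U|\pi_t/\delta)$ with $\pi_t=\pi^2t^2/6$. DEC-HBO chooses each query $\mathbf x_{t+1}$, as a measurable function of $y_1,\dots,y_t$, among the maximizers over $\mathbf x\in\mathcal D$ of $\sum_{\mathcal I\in\mathcal U}\big(\mu_t^{\mathcal I}(\mathbf x^{\mathcal I})+\beta_{t+1}^{1/2}\sigma_t^{\mathcal I}(\mathbf x^{\mathcal I})\big)$. Let $R_n=\sum_{t=1}^n\big(\max_{\mathbf x\in\mathcal D}f(\mathbf x)-f(\mathbf x_t)\big)$ be its cumulative regret. Let $\gamma_n=\sum_{\mathcal I\in\mathcal U}\gamma_n^{\mathcal I}$, where $\gamma_n^{\mathcal I}$ is the maximum, over $n$-tuples $(\mathbf a_1,\dots,\mathbf a_n)$ of inputs in $\mathcal D$ (repetitions allowed), of the Shannon mutual information between $(f_{\mathcal I}(\mathbf a_i^{\mathcal I}))_{i\le n}$ and $(f_{\mathcal I}(\mathbf a_i^{\mathcal I})+\epsilon_i)_{i\le n}$. For $L>0$ put $$C_L=\frac{8\,|\mathcal U|\,\sigma_n^2\,g(\sigma_s^2/\sigma_n^2)}{L},\qquad g(u)=\frac{u}{\log(1+u)}.$$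 Then every $\gamma_n$ is finite and $(C_L\,n\,\beta_n\gamma_n)^{1/2}=o(n)$ for every $L>0$. Moreover there is an event of probability at least $1-\delta$ on which the following holds for every non-increasing $h:\{0,1,2,\dots\}\to\mathbb R$ with limit $L>0$. Consider, for the realized queries, the condition $$h(t-1)\,\sigma_{t-1}^{\mathcal I}(\mathbf x_t^{\mathcal I})^2\le\widehat\sigma_{t-1}^{\mathcal I}(\mathbf x_t^{\mathcal I})^2\quad\text{for all }\mathcal I\in\mathcal U.\tag{$*$}$$ (i) For every $n$ such that $(*)$ holds for $t=1,\dots,n$, one has $R_n\le(C_L\,n\,\beta_n\gamma_n)^{1/2}$. (ii) If $(*)$ holds for all $t\ge1$, then $R_n/n\to0$, i.e. DEC-HBO has no regret asymptotically. In particular, if a deterministic $h$ satisfies $(*)$ almost surely for all $t\ge1$, then with probability at least $1-\delta$ the bound $R_n\le(C_L\,n\,\beta_n\gamma_n)^{1/2}\in o(n)$ holds for all $n$ with the constant $C_L$. -/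

import Mathlib

open MeasureTheory ProbabilityTheory InformationTheory Filter Topology Asymptotics

noncomputable section

namespace DecHBO

/-- Shannon mutual information of two random variables: the Kullback-Leibler divergence of their
joint law from the product of their laws. -/
def mutualInfo {Ω α β : Type*} [MeasurableSpace Ω] [MeasurableSpace α] [MeasurableSpace β]
    (P : Measure Ω) (X : Ω → α) (Y : Ω → β) : ENNReal :=
  klDiv (P.map fun ω => (X ω, Y ω)) ((P.map X).prod (P.map Y))

section Kernel

variable {d : ℕ}

/-- A covariance function `k I` for every set `I` of input components; it takes only the
components of the inputs that lie in `I`. -/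
abbrev FactorKernel (d : ℕ) : Type :=
  (I : Finset (Fin d)) → (I → ℝ) → (I → ℝ) → ℝ

/-- The prior covariance of the factor `I` at two full inputs, through their projections. -/
def factorCov (k : FactorKernel d) (I : Finset (Fin d)) (x z : Fin d → ℝ) : ℝ :=
  k I (I.restrict x) (I.restrict z)

/-- The prior covariance of the objective function: the sum over the factors. -/
def totalCov (k : FactorKernel d) (U : Finset (Finset (Fin d))) (x z : Fin d → ℝ) : ℝ :=
  ∑ I ∈ U, factorCov k I x z

/-- The regularized Gram matrix `K + σ² 1` of a covariance `c` at the first `t` queries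
`q 0, …, q (t - 1)`. -/
def noisyGram (c : (Fin d → ℝ) → (Fin d → ℝ) → ℝ) (σ : ℝ) (t : ℕ) (q : ℕ → Fin d → ℝ) :
    Matrix (Fin t) (Fin t) ℝ :=
  Matrix.of (fun i j : Fin t => c (q i) (q j)) + σ ^ 2 • (1 : Matrix (Fin t) (Fin t) ℝ)

/-- The vector of prior covariances of the factor `I` between `z` and the first `t` queries. -/
def crossCov (k : FactorKernel d) (I : Finset (Fin d)) (t : ℕ) (q : ℕ → Fin d → ℝ)
    (z : Fin d → ℝ) : Fin t → ℝ :=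
  fun i => factorCov k I z (q i)

/-- Posterior mean of the factor `I` at `z`, given the noisy outputs `y 0, …, y (t - 1)` of the
objective function at the first `t` queries. -/
def postMean (k : FactorKernel d) (U : Finset (Finset (Fin d))) (σ : ℝ) (I : Finset (Fin d))
    (t : ℕ) (q : ℕ → Fin d → ℝ) (y : ℕ → ℝ) (z : Fin d → ℝ) : ℝ :=
  crossCov k I t q z ⬝ᵥ ((noisyGram (totalCov k U) σ t q)⁻¹.mulVec fun i : Fin t => y i)

/-- Posterior variance of the factor `I` at `z`, given noisy outputs of the objective function at
the first `t` queries. -/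
def postVar (k : FactorKernel d) (U : Finset (Finset (Fin d))) (σ : ℝ) (I : Finset (Fin d))
    (t : ℕ) (q : ℕ → Fin d → ℝ) (z : Fin d → ℝ) : ℝ :=
  factorCov k I z z -
    crossCov k I t q z ⬝ᵥ ((noisyGram (totalCov k U) σ t q)⁻¹.mulVec (crossCov k I t q z))

/-- Posterior variance of the factor `I` at `z`, given (hypothetical) noisy outputs of the factor
`I` itself at the first `t` queries. -/
def ownPostVar (k : FactorKernel d) (σ : ℝ) (I : Finset (Fin d))
    (t : ℕ) (q : ℕ → Fin d → ℝ) (z : Fin d → ℝ) : ℝ :=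
  factorCov k I z z -
    crossCov k I t q z ⬝ᵥ ((noisyGram (factorCov k I) σ t q)⁻¹.mulVec (crossCov k I t q z))

/-- The additive upper-confidence-bound acquisition function with exploration parameter `β`. -/
def acquisition (k : FactorKernel d) (U : Finset (Finset (Fin d))) (σ β : ℝ)
    (t : ℕ) (q : ℕ → Fin d → ℝ) (y : ℕ → ℝ) (z : Fin d → ℝ) : ℝ :=
  ∑ I ∈ U, (postMean k U σ I t q y z + √β * √(postVar k U σ I t q z))

/-- At the query `q t` (chosen after `t` observations), the posterior variance of every factor
given outputs of the objective function, times `h t`, is at most its posterior variance given the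
factor's own outputs. -/
def VarianceComparableAt (k : FactorKernel d) (U : Finset (Finset (Fin d))) (σ : ℝ)
    (q : ℕ → Fin d → ℝ) (h : ℕ → ℝ) (t : ℕ) : Prop :=
  ∀ I ∈ U, h t * postVar k U σ I t q (q t) ≤ ownPostVar k σ I t q (q t)

/-- The exploration parameter `β_t = 2 log (|D| |U| π_t / δ)` with `π_t = π² t² / 6`, `t ≥ 1`. -/
def beta (D : Finset (Fin d → ℝ)) (U : Finset (Finset (Fin d))) (δ : ℝ) (t : ℕ) : ℝ :=
  2 * Real.log (D.card * U.card * (Real.pi ^ 2 * t ^ 2 / 6) / δ)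

/-- The constant `C = 8 |U| σ² g(s² / σ²) / L` with `g(u) = u / log (1 + u)`, where `σ²` is the noise
variance, `s²` the signal variance and `L` the limit of the comparison function. -/
def regretConst (U : Finset (Finset (Fin d))) (σ s L : ℝ) : ℝ :=
  8 * U.card * σ ^ 2 * ((s ^ 2 / σ ^ 2) / Real.log (1 + s ^ 2 / σ ^ 2)) / L

end Kernel

section Random

variable {d : ℕ} {Ω : Type*} [MeasurableSpace Ω]

/-- A random function for every set `I` of input components. -/
abbrev FactorProcess (d : ℕ) (Ω : Type*) : Type _ :=
  (I : Finset (Fin d)) → (I → ℝ) → Ω → ℝ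

/-- The objective function `f(x) = ∑_{I ∈ U} f_I(x^I)`. -/
def objective (U : Finset (Finset (Fin d))) (f : FactorProcess d Ω) (x : Fin d → ℝ) (ω : Ω) : ℝ :=
  ∑ I ∈ U, f I (I.restrict x) ω

/-- The factors are independent centred Gaussian processes with covariance functions `k I` on the
input domain `D`, and the noise variables are i.i.d. `N(0, σ²)` and independent of the factors. -/
structure IsGaussianFactorModel (P : Measure Ω) (D : Finset (Fin d → ℝ))
    (U : Finset (Finset (Fin d))) (k : FactorKernel d) (σ : ℝ)
    (f : FactorProcess d Ω) (ε : ℕ → Ω → ℝ) : Prop where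
  gaussian : ∀ I ∈ U, IsGaussianProcess (fun x : D => f I (I.restrict x.1)) P
  mean_zero : ∀ I ∈ U, ∀ x ∈ D, ∫ ω, f I (I.restrict x) ω ∂P = 0
  cov_eq : ∀ I ∈ U, ∀ x ∈ D, ∀ z ∈ D,
    covariance (f I (I.restrict x)) (f I (I.restrict z)) P = k I (I.restrict x) (I.restrict z)
  indep : iIndepFun (fun (I : U) (ω : Ω) (x : D) => f I.1 (I.1.restrict x.1) ω) P
  noise_law : ∀ t, HasLaw (ε t) (gaussianReal 0 (Real.toNNReal (σ ^ 2))) P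
  noise_indep : iIndepFun ε P
  noise_indep_factors :
    IndepFun (fun (ω : Ω) (p : U × D) => f p.1.1 (p.1.1.restrict p.2.1) ω)
      (fun (ω : Ω) (t : ℕ) => ε t ω) P

/-- The noisy observed output at the query `x t`. -/
def observation (U : Finset (Finset (Fin d))) (f : FactorProcess d Ω) (ε : ℕ → Ω → ℝ)
    (x : ℕ → Ω → Fin d → ℝ) (t : ℕ) (ω : Ω) : ℝ :=
  objective U f (x t ω) ω + ε t ω

/-- `x 0, x 1, …` are the queries of DEC-HBO: `x t` (the query of iteration `t + 1`) is chosen from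
the outputs observed so far and maximizes over `D` the additive acquisition function with parameter
`β_{t+1}`. Ties are broken by any measurable rule. -/
structure IsDecHBO (D : Finset (Fin d → ℝ)) (U : Finset (Finset (Fin d))) (k : FactorKernel d)
    (σ δ : ℝ) (f : FactorProcess d Ω) (ε : ℕ → Ω → ℝ) (x : ℕ → Ω → Fin d → ℝ) : Prop where
  mem : ∀ t ω, x t ω ∈ D
  nonanticipating : ∀ t, ∃ s : (Fin t → ℝ) → (Fin d → ℝ), Measurable s ∧
    ∀ ω, x t ω = s (fun i => observation U f ε x i ω)
  maximizes : ∀ t ω, ∀ z ∈ D,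
    acquisition k U σ (beta D U δ (t + 1)) t (fun i => x i ω)
        (fun i => observation U f ε x i ω) z ≤
      acquisition k U σ (beta D U δ (t + 1)) t (fun i => x i ω)
        (fun i => observation U f ε x i ω) (x t ω)

/-- The cumulative regret of the first `n` queries. -/
def cumRegret (D : Finset (Fin d → ℝ)) (hD : D.Nonempty) (U : Finset (Finset (Fin d)))
    (f : FactorProcess d Ω) (x : ℕ → Ω → Fin d → ℝ) (n : ℕ) (ω : Ω) : ℝ :=
  ∑ t ∈ Finset.range n, (D.sup' hD (fun z => objective U f z ω) - objective U f (x t ω) ω)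

/-- The maximum information gain of the factor `I`: the largest mutual information between the
values of the factor at `n` inputs of `D` (repetitions allowed) and noisy outputs of that factor at
these inputs. -/
def maxInfoGain (P : Measure Ω) (D : Finset (Fin d → ℝ)) (f : FactorProcess d Ω)
    (ε : ℕ → Ω → ℝ) (I : Finset (Fin d)) (n : ℕ) : ENNReal :=
  ⨆ a : Fin n → D, mutualInfo P
    (fun (ω : Ω) (i : Fin n) => f I (I.restrict (a i).1) ω)
    (fun (ω : Ω) (i : Fin n) => f I (I.restrict (a i).1) ω + ε i ω)

/-- The total maximum information gain: the sum over the factors. -/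
def totalInfoGain (P : Measure Ω) (D : Finset (Fin d → ℝ)) (U : Finset (Finset (Fin d)))
    (f : FactorProcess d Ω) (ε : ℕ → Ω → ℝ) (n : ℕ) : ENNReal :=
  ∑ I ∈ U, maxInfoGain P D f ε I n

/-- The regret bound `(C n β_n γ_n)^{1/2}`. -/
def regretBound (P : Measure Ω) (D : Finset (Fin d → ℝ)) (U : Finset (Finset (Fin d)))
    (f : FactorProcess d Ω) (ε : ℕ → Ω → ℝ) (δ C : ℝ) (n : ℕ) : ℝ :=
  √(C * n * beta D U δ n * (totalInfoGain P D U f ε n).toReal)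

end Random

end DecHBO

end

/-! The proof is the upper-confidence-bound argument for Gaussian process bandits, carried out
factor by factor.

Confidence. The queries are random, but `D` is finite, so only finitely many designs of length `t`
occur. Whether the algorithm follows a given design is decided by the outputs under that design, and
the Gaussian posterior error for that fixed design is independent of these outputs. Each piece
therefore obeys the plain Gaussian tail bound, and summing over designs gives
`measure_postMean_deviation_le`. With the chosen `β_t`, the union bound over time, factors and
inputs totals `δ · ∑ 6 / (π² t²) = δ` (`exists_confidence_event`).

Regret. On the confidence event a query loses at most `2 √β_t` times the sum of the factors'
posterior deviations (`regret_le_of_confidence`). Cauchy–Schwarz over the `|U| n` pairs of factor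
and time reduces the claim to a sum of posterior variances. The comparison condition, with `h ≥ L`,
replaces each by `1/L` times the factor's own posterior variance, and `a ≤ g(u) log (1 + a)` for `0
≤ a ≤ u` turns these into logarithms, whose sum is at most twice the information gain
(`sum_postVar_le`). The constant `8 |U|` is `2² · |U| · 2`.

Information. Subtracting from each output its prediction from the earlier ones is a unit triangular
linear map, and it makes the outputs independent with variances `ownPostVar + σ²`. Densities are
then explicit and give `mutualInfo_eq`.

Sublinearity. After `m` visits of an input, its own posterior variance is at most `σ² / m`; since
`D` is finite, the gain is `O(log n)` (`maxInfoGain_le`). As `β_n` is also `O(log n)`, the bound is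
`O(√n log n)`. -/

noncomputable section

namespace DecHBO

/-! ### Gaussian tail bounds. -/

section GaussianTail

/-- Shift by `c` and drop the nonnegative cross term of `(x + c) ^ 2`. Keeping the mass of the
half-line on the right, instead of bounding it by one, gives the two-sided tail the constant 1
rather than 2. -/
lemma gaussianReal_Ioi_le (v : NNReal) (hv : v ≠ 0) {c : ℝ} (hc : 0 ≤ c) :
    gaussianReal 0 v (Set.Ioi c) ≤
      ENNReal.ofReal (Real.exp (-c ^ 2 / (2 * v))) * gaussianReal 0 v (Set.Ioi 0) := by
  rw [gaussianReal_apply _ hv, gaussianReal_apply _ hv,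
    ← lintegral_const_mul _ (measurable_gaussianPDF 0 v)]
  have hshift : ∫⁻ x in Set.Ioi c, gaussianPDF 0 v x
      = ∫⁻ x in Set.Ioi (0 : ℝ), gaussianPDF 0 v (x + c) := by
    have h := (measurePreserving_add_right (volume : Measure ℝ) c).setLIntegral_comp_preimage_emb
      (MeasurableEquiv.addRight c).measurableEmbedding (gaussianPDF 0 v) (Set.Ioi c)
    rw [← h]
    congr 2
    ext x; simp
  rw [hshift]
  refine setLIntegral_mono' measurableSet_Ioi fun x hx => ?_
  have hx : 0 < x := hx
  have hv' : (0 : ℝ) < v := by positivity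
  rw [gaussianPDF, gaussianPDF, ← ENNReal.ofReal_mul (Real.exp_nonneg _)]
  refine ENNReal.ofReal_le_ofReal ?_
  rw [gaussianPDFReal, gaussianPDFReal, mul_left_comm, ← Real.exp_add]
  gcongr
  rw [← add_div]
  gcongr
  nlinarith [mul_nonneg hx.le hc]

lemma gaussianReal_abs_gt_le (v : NNReal) {β : ℝ} (hβ : 0 ≤ β) :
    gaussianReal 0 v {x | √β * √v < |x|} ≤ ENNReal.ofReal (Real.exp (-β / 2)) := by
  rcases eq_or_ne v 0 with rfl | hv
  -- Zero variance is a Dirac mass at 0, which misses `{x | 0 < |x|}`. A posterior variance may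
  -- vanish, so this case is needed.
  · have : gaussianReal 0 0 {x : ℝ | √β * √((0 : NNReal) : ℝ) < |x|} = 0 := by
      rw [gaussianReal_zero_var, Measure.dirac_apply' _ (measurableSet_lt (by fun_prop) (by fun_prop))]
      simp
    rw [this]; exact zero_le
  set c := √β * √v with hc
  have hc0 : 0 ≤ c := by positivity
  have hv' : (0 : ℝ) < v := by positivity
  have hexp : -c ^ 2 / (2 * v) = -β / 2 := by
    rw [hc, mul_pow, Real.sq_sqrt hβ, Real.sq_sqrt hv'.le]; field_simp
  have hset : {x : ℝ | c < |x|} = Set.Ioi c ∪ (fun x => -x) ⁻¹' (Set.Ioi c) := by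
    ext x; simp [lt_abs, lt_neg]
  have hneg : ∀ a : ℝ, gaussianReal 0 v ((fun x => -x) ⁻¹' (Set.Ioi a)) =
      gaussianReal 0 v (Set.Ioi a) := by
    intro a
    rw [← Measure.map_apply measurable_neg measurableSet_Ioi, gaussianReal_map_neg, neg_zero]
  have hhalf : gaussianReal 0 v (Set.Ioi 0) + gaussianReal 0 v (Set.Ioi 0) ≤ 1 := by
    conv_lhs => rw [← hneg 0]
    conv_lhs => enter [2]; rw [hneg 0]
    rw [← measure_union]
    · exact prob_le_one
    · rw [Set.disjoint_left]; intro x; simp; intro h; exact h.le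
    · exact measurableSet_Ioi
  calc gaussianReal 0 v {x | c < |x|}
      ≤ gaussianReal 0 v (Set.Ioi c) + gaussianReal 0 v (Set.Ioi c) := by
        rw [hset]
        refine (measure_union_le _ _).trans ?_
        rw [hneg]
    _ ≤ ENNReal.ofReal (Real.exp (-β / 2)) *
        (gaussianReal 0 v (Set.Ioi 0) + gaussianReal 0 v (Set.Ioi 0)) := by
        rw [mul_add, ← hexp]
        gcongr <;> exact gaussianReal_Ioi_le v hv hc0
    _ ≤ _ := by simpa using mul_le_mul_right hhalf (ENNReal.ofReal (Real.exp (-β / 2)))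

end GaussianTail

/-! ### Densities of Gaussian vectors. -/

section Density

lemma pi_gaussianReal_eq_withDensity {ι : Type*} [Fintype ι] (v : ι → NNReal) (hv : ∀ i, v i ≠ 0) :
    Measure.pi (fun i => gaussianReal 0 (v i)) =
      (volume : Measure (ι → ℝ)).withDensity
        fun x => ENNReal.ofReal (∏ i, gaussianPDFReal 0 (v i) (x i)) := by
  refine Measure.pi_eq fun s hs => ?_
  have hnn : ∀ x : ι → ℝ, 0 ≤ ∏ i, gaussianPDFReal 0 (v i) (x i) := fun x =>
    Finset.prod_nonneg fun i _ => gaussianPDFReal_nonneg _ _ _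
  have hInt : Integrable fun x : ι → ℝ => ∏ i, gaussianPDFReal 0 (v i) (x i) :=
    Integrable.fintype_prod fun i => integrable_gaussianPDFReal 0 (v i)
  have hind : ∀ x : ι → ℝ, (Set.univ.pi s).indicator
      (fun x : ι → ℝ => ∏ i, gaussianPDFReal 0 (v i) (x i)) x =
      ∏ i, (s i).indicator (gaussianPDFReal 0 (v i)) (x i) := by
    intro x
    by_cases hx : ∀ i, x i ∈ s i
    · rw [Set.indicator_of_mem (by simpa [Set.mem_univ_pi] using hx)]
      exact Finset.prod_congr rfl fun i _ => (Set.indicator_of_mem (hx i) _).symm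
    · rw [Set.indicator_of_notMem (by simpa [Set.mem_univ_pi] using hx)]
      push Not at hx
      obtain ⟨i, hi⟩ := hx
      exact (Finset.prod_eq_zero (Finset.mem_univ i) (Set.indicator_of_notMem hi _)).symm
  rw [withDensity_apply _ (MeasurableSet.univ_pi hs),
    ← ofReal_integral_eq_lintegral_ofReal hInt.integrableOn (ae_of_all _ hnn),
    ← integral_indicator (MeasurableSet.univ_pi hs), integral_congr_ae (ae_of_all _ hind),
    integral_fintype_prod_volume_eq_prod (fun i => (s i).indicator (gaussianPDFReal 0 (v i))),
    ENNReal.ofReal_prod_of_nonneg fun i _ => integral_nonneg fun x =>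
      Set.indicator_nonneg (fun y _ => gaussianPDFReal_nonneg _ _ _) x]
  refine Finset.prod_congr rfl fun i _ => ?_
  rw [gaussianReal_apply_eq_integral _ (hv i), integral_indicator (hs i)]

/-- If a volume-preserving linear image of a random vector has independent centred Gaussian
components, then the vector has the corresponding product of Gaussian densities. -/
lemma map_eq_withDensity_of_iIndepFun_mulVec {Ω ι : Type*} [MeasurableSpace Ω] {P : Measure Ω}
    [IsProbabilityMeasure P] [Fintype ι] [DecidableEq ι] {Y : Ω → ι → ℝ} (hY : AEMeasurable Y P)
    {T : Matrix ι ι ℝ} (hT : T.det = 1) {v : ι → NNReal} (hv : ∀ i, v i ≠ 0)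
    (hind : iIndepFun (fun i ω => T.mulVec (Y ω) i) P)
    (hlaw : ∀ i, P.map (fun ω => T.mulVec (Y ω) i) = gaussianReal 0 (v i)) :
    P.map Y = volume.withDensity
      fun y => ENNReal.ofReal (∏ i, gaussianPDFReal 0 (v i) (T.mulVec y i)) := by
  have hTm : Measurable fun y : ι → ℝ => T.mulVec y :=
    (LinearMap.continuous_on_pi (Matrix.toLin' T)).measurable
  have hTY : AEMeasurable (fun ω => T.mulVec (Y ω)) P := hTm.comp_aemeasurable hY
  have hTYi : ∀ i, AEMeasurable (fun ω => T.mulVec (Y ω) i) P := fun i =>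
    (measurable_pi_apply i).comp_aemeasurable hTY
  have hmap : P.map (fun ω => T.mulVec (Y ω)) = volume.withDensity
      fun x => ENNReal.ofReal (∏ i, gaussianPDFReal 0 (v i) (x i)) := by
    rw [← pi_gaussianReal_eq_withDensity v hv]
    have := (iIndepFun_iff_map_fun_eq_pi_map hTYi).1 hind
    simp_rw [hlaw] at this
    exact this
  -- Determinant one makes the Jacobian factor disappear from the change of variables.
  have hvol : (volume : Measure (ι → ℝ)).map (fun y => T.mulVec y) = volume := by
    have := Real.map_matrix_volume_pi_eq_smul_volume_pi (M := T) (by simp [hT])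
    simp only [hT, inv_one, abs_one, ENNReal.ofReal_one, one_smul] at this
    exact this
  have hunit : IsUnit T.det := by simp [hT]
  have hinv : ∀ y : ι → ℝ, T⁻¹.mulVec (T.mulVec y) = y := fun y => by
    rw [Matrix.mulVec_mulVec, Matrix.nonsing_inv_mul _ hunit, Matrix.one_mulVec]
  have hTm' : Measurable fun y : ι → ℝ => T⁻¹.mulVec y :=
    (LinearMap.continuous_on_pi (Matrix.toLin' T⁻¹)).measurable
  have hpdf : Measurable fun x : ι → ℝ =>
      ENNReal.ofReal (∏ i, gaussianPDFReal 0 (v i) (x i)) := by fun_prop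
  refine Measure.ext_of_lintegral _ fun g hg => ?_
  have hgT : Measurable fun x : ι → ℝ => g (T⁻¹.mulVec x) := hg.comp hTm'
  have hprod : Measurable fun x : ι → ℝ =>
      ENNReal.ofReal (∏ i, gaussianPDFReal 0 (v i) (x i)) * g (T⁻¹.mulVec x) := hpdf.mul hgT
  have hpdfT : Measurable fun y : ι → ℝ =>
      ENNReal.ofReal (∏ i, gaussianPDFReal 0 (v i) (T.mulVec y i)) := hpdf.comp hTm
  calc ∫⁻ y, g y ∂(P.map Y)
      = ∫⁻ x, g (T⁻¹.mulVec x) ∂(P.map fun ω => T.mulVec (Y ω)) := by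
        rw [lintegral_map' hg.aemeasurable hY, lintegral_map' hgT.aemeasurable hTY]
        simp only [hinv]
    _ = ∫⁻ x, ENNReal.ofReal (∏ i, gaussianPDFReal 0 (v i) (x i)) * g (T⁻¹.mulVec x) := by
        rw [hmap, lintegral_withDensity_eq_lintegral_mul _ hpdf hgT]
        rfl
    _ = ∫⁻ y, ENNReal.ofReal (∏ i, gaussianPDFReal 0 (v i) (T.mulVec y i)) * g y := by
        conv_lhs => rw [← hvol]
        rw [lintegral_map hprod hTm]
        simp only [hinv]
    _ = _ := by
        rw [lintegral_withDensity_eq_lintegral_mul _ hpdfT hg]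
        rfl

end Density

/-! ### Mutual information of a signal and its noisy version. -/

section KL

variable {Ω : Type*} [MeasurableSpace Ω] {P : Measure Ω} [IsProbabilityMeasure P]

/-- The joint law of a signal and its noisy version has an explicit density with respect to the
product of the marginals. -/
lemma map_prodMk_add_eq_withDensity {n : ℕ} {F e : Ω → Fin n → ℝ}
    (hF : AEMeasurable F P) (he : AEMeasurable e P) (hind : IndepFun F e P)
    {p q : (Fin n → ℝ) → ℝ} (hp : Measurable p) (hq : Measurable q)
    (hq0 : ∀ x, 0 < q x)
    (hpe : P.map e = volume.withDensity fun x => ENNReal.ofReal (p x))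
    (hqe : P.map (fun ω => F ω + e ω) = volume.withDensity fun x => ENNReal.ofReal (q x)) :
    P.map (fun ω => (F ω, F ω + e ω)) =
      ((P.map F).prod (P.map fun ω => F ω + e ω)).withDensity
        fun z => ENNReal.ofReal (p (z.2 - z.1) / q z.2) := by
  have hJ : P.map (fun ω => (F ω, F ω + e ω)) =
      ((P.map F).prod (P.map e)).map fun z => (z.1, z.1 + z.2) := by
    rw [← (indepFun_iff_map_prod_eq_prod_map_map hF he).1 hind,
      AEMeasurable.map_map_of_aemeasurable (by fun_prop) (by fun_prop)]
    rfl
  have : IsProbabilityMeasure (P.map F) := Measure.isProbabilityMeasure_map hF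
  have : IsProbabilityMeasure (P.map e) := Measure.isProbabilityMeasure_map he
  have : IsProbabilityMeasure (P.map fun ω => F ω + e ω) :=
    Measure.isProbabilityMeasure_map (by fun_prop)
  refine Measure.ext_of_lintegral _ fun g hg => ?_
  have hr : Measurable fun z : (Fin n → ℝ) × (Fin n → ℝ) =>
      ENNReal.ofReal (p (z.2 - z.1) / q z.2) := by fun_prop
  rw [hJ, lintegral_map hg (by fun_prop), lintegral_prod _ (by fun_prop),
    lintegral_withDensity_eq_lintegral_mul _ hr hg, lintegral_prod _ (by fun_prop)]
  refine lintegral_congr fun x => ?_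
  -- For a fixed signal value `x`, translation invariance of Lebesgue measure turns the noise
  -- density `p` into `p (y - x)`. The law of the signal itself needs no density.
  rw [hpe, hqe, lintegral_withDensity_eq_lintegral_mul _ (by fun_prop) (by fun_prop),
    lintegral_withDensity_eq_lintegral_mul _ (by fun_prop) (by fun_prop),
    ← lintegral_sub_right_eq_self _ x]
  refine lintegral_congr fun y => ?_
  simp only [Pi.mul_apply, ← mul_assoc, ← ENNReal.ofReal_mul (hq0 y).le]
  congr 2
  · rw [mul_div_cancel₀ _ (hq0 y).ne']
  · simp

/-- This is the differential entropy of the output minus that of the noise. Only noise and output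
need densities, so a degenerate signal, as produced by repeated inputs, is allowed. -/
lemma mutualInfo_add_eq {n : ℕ} {F e : Ω → Fin n → ℝ}
    (hF : AEMeasurable F P) (he : AEMeasurable e P) (hind : IndepFun F e P)
    {p q : (Fin n → ℝ) → ℝ} (hp : Measurable p) (hq : Measurable q) (hp0 : ∀ x, 0 < p x)
    (hq0 : ∀ x, 0 < q x)
    (hpe : P.map e = volume.withDensity fun x => ENNReal.ofReal (p x))
    (hqe : P.map (fun ω => F ω + e ω) = volume.withDensity fun x => ENNReal.ofReal (q x))
    (hInt : Integrable (fun ω => Real.log (p (e ω)) - Real.log (q (F ω + e ω))) P) :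
    mutualInfo P F (fun ω => F ω + e ω) =
      ENNReal.ofReal (∫ ω, (Real.log (p (e ω)) - Real.log (q (F ω + e ω))) ∂P) := by
  have hFe : AEMeasurable (fun ω => F ω + e ω) P := by fun_prop
  have hJm : AEMeasurable (fun ω => (F ω, F ω + e ω)) P := by fun_prop
  have : IsProbabilityMeasure (P.map F) := Measure.isProbabilityMeasure_map hF
  have : IsProbabilityMeasure (P.map fun ω => F ω + e ω) := Measure.isProbabilityMeasure_map hFe
  have : IsProbabilityMeasure (P.map fun ω => (F ω, F ω + e ω)) :=
    Measure.isProbabilityMeasure_map hJm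
  have hr : Measurable fun z : (Fin n → ℝ) × (Fin n → ℝ) =>
      ENNReal.ofReal (p (z.2 - z.1) / q z.2) := by fun_prop
  have hd := map_prodMk_add_eq_withDensity hF he hind hp hq hq0 hpe hqe
  set J := P.map fun ω => (F ω, F ω + e ω) with hJ
  set N := (P.map F).prod (P.map fun ω => F ω + e ω) with hN
  have hac : J ≪ N := by rw [hd]; exact withDensity_absolutelyContinuous _ _
  have hrn : J.rnDeriv N =ᵐ[J] fun z => ENNReal.ofReal (p (z.2 - z.1) / q z.2) := by
    refine hac.ae_le ?_
    rw [hd]; exact Measure.rnDeriv_withDensity N hr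
  have hllr : llr J N =ᵐ[J] fun z => Real.log (p (z.2 - z.1)) - Real.log (q z.2) := by
    filter_upwards [hrn] with z hz
    rw [llr, hz, ENNReal.toReal_ofReal (div_nonneg (hp0 _).le (hq0 _).le),
      Real.log_div (hp0 _).ne' (hq0 _).ne']
  have hmeas : Measurable fun z : (Fin n → ℝ) × (Fin n → ℝ) =>
      Real.log (p (z.2 - z.1)) - Real.log (q z.2) := by fun_prop
  have hInt' : Integrable (llr J N) J := by
    rw [integrable_congr hllr, hJ, integrable_map_measure hmeas.aestronglyMeasurable hJm]
    simpa [Function.comp_def] using hInt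
  -- `klDiv` carries a correction by the two total masses; both measures are probabilities, so it
  -- cancels.
  rw [mutualInfo, klDiv_of_ac_of_integrable hac hInt', integral_congr_ae hllr, hJ,
    integral_map hJm hmeas.aestronglyMeasurable]
  simp

lemma log_gaussianPDFReal {v : NNReal} (hv : v ≠ 0) (x : ℝ) :
    Real.log (gaussianPDFReal 0 v x) = -Real.log (2 * Real.pi * v) / 2 - x ^ 2 / (2 * v) := by
  have hv' : (0 : ℝ) < v := by positivity
  rw [gaussianPDFReal, Real.log_mul (by positivity) (Real.exp_ne_zero _), Real.log_exp,
    Real.log_inv, Real.log_sqrt (by positivity)]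
  simp; ring

lemma integrable_log_gaussianPDFReal {X : Ω → ℝ} {v : NNReal} (hv : v ≠ 0)
    (hX : HasLaw X (gaussianReal 0 v) P) :
    Integrable (fun ω => Real.log (gaussianPDFReal 0 v (X ω))) P := by
  simp_rw [log_gaussianPDFReal hv]
  exact (integrable_const _).sub
    ((hX.hasGaussianLaw.memLp_two.integrable_sq).div_const _)

/-- The term `1 / 2` does not depend on the variance, so it cancels between noise and output and
only a ratio of variances remains. -/
lemma integral_log_gaussianPDFReal {X : Ω → ℝ} {v : NNReal} (hv : v ≠ 0)
    (hX : HasLaw X (gaussianReal 0 v) P) :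
    ∫ ω, Real.log (gaussianPDFReal 0 v (X ω)) ∂P = -Real.log (2 * Real.pi * v) / 2 - 1 / 2 := by
  have hv' : (v : ℝ) ≠ 0 := by exact_mod_cast hv
  have hsq : ∫ ω, X ω ^ 2 ∂P = v := by
    have h1 : ∫ ω, X ω ∂P = 0 := by rw [hX.integral_eq]; simp
    have h2 : Var[X; P] = v := by rw [hX.variance_eq]; simp
    rw [variance_of_integral_eq_zero hX.aemeasurable h1] at h2
    exact h2
  simp_rw [log_gaussianPDFReal hv]
  rw [integral_sub (integrable_const _)
    ((hX.hasGaussianLaw.memLp_two.integrable_sq).div_const _), integral_div (2 * (v : ℝ)), hsq,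
    integral_const]
  simp; field_simp

/-- The mutual information between a random vector and its version with white Gaussian noise, when
a volume-preserving linear image of the latter has independent centred Gaussian components. -/
lemma mutualInfo_add_eq_sum_log {n : ℕ} {F e : Ω → Fin n → ℝ}
    (hF : AEMeasurable F P) (hind : IndepFun F e P) {v : NNReal} (hv : v ≠ 0)
    (he : ∀ i, HasLaw (fun ω => e ω i) (gaussianReal 0 v) P) (heind : iIndepFun (fun i ω => e ω i) P)
    {T : Matrix (Fin n) (Fin n) ℝ} (hT : T.det = 1) {s : Fin n → NNReal} (hs : ∀ i, s i ≠ 0)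
    (hVind : iIndepFun (fun i ω => T.mulVec (F ω + e ω) i) P)
    (hV : ∀ i, HasLaw (fun ω => T.mulVec (F ω + e ω) i) (gaussianReal 0 (s i)) P) :
    mutualInfo P F (fun ω => F ω + e ω) =
      ENNReal.ofReal (∑ i, Real.log (s i / v) / 2) := by
  have hem : AEMeasurable e P := aemeasurable_pi_iff.2 fun i => (he i).aemeasurable
  have hTm : Measurable fun y : Fin n → ℝ => T.mulVec y :=
    (LinearMap.continuous_on_pi (Matrix.toLin' T)).measurable
  have hpe : P.map e = volume.withDensity
      fun x => ENNReal.ofReal (∏ i, gaussianPDFReal 0 v (x i)) := by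
    -- White noise has independent components already, so the identity serves as the
    -- volume-preserving map.
    have := map_eq_withDensity_of_iIndepFun_mulVec hem (T := 1) Matrix.det_one (v := fun _ => v)
      (fun _ => hv) (by simpa using heind) (fun i => by simpa using (he i).map_eq)
    simpa using this
  have hqe := map_eq_withDensity_of_iIndepFun_mulVec (hF.add hem) hT hs hVind
    (fun i => (hV i).map_eq)
  have hlogp : ∀ ω, Real.log (∏ i, gaussianPDFReal 0 v (e ω i)) =
      ∑ i, Real.log (gaussianPDFReal 0 v (e ω i)) := fun ω =>
    Real.log_prod fun i _ => (gaussianPDFReal_pos _ _ _ hv).ne'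
  have hlogq : ∀ ω, Real.log (∏ i, gaussianPDFReal 0 (s i) (T.mulVec (F ω + e ω) i)) =
      ∑ i, Real.log (gaussianPDFReal 0 (s i) (T.mulVec (F ω + e ω) i)) := fun ω =>
    Real.log_prod fun i _ => (gaussianPDFReal_pos _ _ _ (hs i)).ne'
  have hpi := fun i => integrable_log_gaussianPDFReal hv (he i)
  have hqi := fun i => integrable_log_gaussianPDFReal (hs i) (hV i)
  have hpI := integrable_finsetSum Finset.univ fun i _ => hpi i
  have hqI := integrable_finsetSum Finset.univ fun i _ => hqi i
  rw [mutualInfo_add_eq hF hem hind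
    (p := fun x => ∏ i, gaussianPDFReal 0 v (x i))
    (q := fun x => ∏ i, gaussianPDFReal 0 (s i) (T.mulVec x i)) (by fun_prop)
    (Finset.measurable_prod _ fun i _ => (measurable_gaussianPDFReal 0 (s i)).comp
      ((measurable_pi_apply i).comp hTm))
    (fun x => Finset.prod_pos fun i _ => gaussianPDFReal_pos _ _ _ hv)
    (fun x => Finset.prod_pos fun i _ => gaussianPDFReal_pos _ _ _ (hs i)) hpe hqe
    (by simp_rw [hlogp, hlogq]; exact hpI.sub hqI)]
  simp_rw [hlogp, hlogq]
  rw [integral_sub hpI hqI, integral_finsetSum _ fun i _ => hpi i,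
    integral_finsetSum _ fun i _ => hqi i, ← Finset.sum_sub_distrib]
  congr 1
  refine Finset.sum_congr rfl fun i _ => ?_
  have hv' : (0 : ℝ) < v := by positivity
  have hs' : (0 : ℝ) < s i := by have := hs i; positivity
  rw [integral_log_gaussianPDFReal hv (he i), integral_log_gaussianPDFReal (hs i) (hV i),
    Real.log_mul (by positivity) hv'.ne', Real.log_mul (by positivity) hs'.ne',
    Real.log_div hs'.ne' hv'.ne']
  ring

end KL

/-! ### Best linear prediction and its residual. -/

section Regression

variable {Ω : Type*} [MeasurableSpace Ω] {P : Measure Ω} {ι : Type*} [Fintype ι]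
  {X : Ω → ℝ} {Y : ι → Ω → ℝ}

lemma memLp_dotProduct (hY : ∀ i, MemLp (Y i) 2 P) (w : ι → ℝ) :
    MemLp (fun ω => w ⬝ᵥ fun i => Y i ω) 2 P :=
  memLp_finsetSum _ fun i _ => (hY i).const_mul (w i)

lemma covariance_dotProduct_right [IsFiniteMeasure P] (hX : MemLp X 2 P)
    (hY : ∀ i, MemLp (Y i) 2 P) (w : ι → ℝ) :
    cov[X, fun ω => w ⬝ᵥ fun i => Y i ω; P] = ∑ i, w i * cov[X, Y i; P] := by
  simp only [dotProduct]
  rw [covariance_fun_sum_right (fun i => (hY i).const_mul (w i)) hX]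
  simp_rw [covariance_const_mul_right]

variable [DecidableEq ι] {A : Matrix ι ι ℝ} {c : ι → ℝ}

lemma memLp_residual (hX : MemLp X 2 P) (hY : ∀ i, MemLp (Y i) 2 P) :
    MemLp (fun ω => X ω - c ⬝ᵥ A⁻¹.mulVec (fun i => Y i ω)) 2 P := by
  simp_rw [Matrix.dotProduct_mulVec]
  exact hX.sub (memLp_dotProduct hY _)

variable [IsProbabilityMeasure P]

/-- The residual of the best linear predictor is uncorrelated with the predictors. -/
lemma covariance_residual (hX : MemLp X 2 P) (hY : ∀ i, MemLp (Y i) 2 P)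
    (hA : ∀ i j, cov[Y i, Y j; P] = A i j) (hdet : IsUnit A.det) (hc : ∀ i, cov[X, Y i; P] = c i)
    (j : ι) :
    cov[fun ω => X ω - c ⬝ᵥ A⁻¹.mulVec (fun i => Y i ω), Y j; P] = 0 := by
  simp_rw [Matrix.dotProduct_mulVec]
  rw [covariance_fun_sub_left hX (memLp_dotProduct hY _) (hY j), hc,
    covariance_comm, covariance_dotProduct_right (hY j) hY]
  have : ∑ i, Matrix.vecMul c A⁻¹ i * cov[Y j, Y i; P] = Matrix.vecMul (Matrix.vecMul c A⁻¹) A j := by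
    simp_rw [covariance_comm (Y j), hA]
    rfl
  rw [this, Matrix.vecMul_vecMul, Matrix.nonsing_inv_mul _ hdet, Matrix.vecMul_one, sub_self]

/-- The residual is orthogonal to the predictors, so its variance equals its covariance with `X`.
Only second moments matter here. -/
lemma variance_residual (hX : MemLp X 2 P) (hY : ∀ i, MemLp (Y i) 2 P)
    (hA : ∀ i j, cov[Y i, Y j; P] = A i j) (hdet : IsUnit A.det)
    (hc : ∀ i, cov[X, Y i; P] = c i) :
    Var[fun ω => X ω - c ⬝ᵥ A⁻¹.mulVec (fun i => Y i ω); P] =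
      Var[X; P] - c ⬝ᵥ A⁻¹.mulVec c := by
  have hZ : MemLp (fun ω => X ω - c ⬝ᵥ A⁻¹.mulVec (fun i => Y i ω)) 2 P := memLp_residual hX hY
  have h0 := covariance_residual hX hY hA hdet hc
  rw [← covariance_self hZ.aemeasurable]
  set Z := fun ω => X ω - c ⬝ᵥ A⁻¹.mulVec (fun i => Y i ω) with hZdef
  have hsplit : cov[Z, Z; P] = cov[Z, X; P] := by
    conv_lhs => enter [2]; rw [hZdef]
    simp_rw [Matrix.dotProduct_mulVec]
    rw [covariance_fun_sub_right hZ hX (memLp_dotProduct hY _),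
      covariance_dotProduct_right hZ hY]
    simp [h0]
  rw [hsplit, hZdef, covariance_comm]
  simp_rw [Matrix.dotProduct_mulVec]
  rw [covariance_fun_sub_right hX hX (memLp_dotProduct hY _), covariance_self hX.aemeasurable,
    covariance_dotProduct_right hX hY]
  simp [hc, dotProduct]

/-- The best linear predictor minimizes the variance of the residual. -/
lemma variance_residual_le (hX : MemLp X 2 P) (hY : ∀ i, MemLp (Y i) 2 P)
    (hA : ∀ i j, cov[Y i, Y j; P] = A i j) (hdet : IsUnit A.det)
    (hc : ∀ i, cov[X, Y i; P] = c i) (w : ι → ℝ) :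
    Var[X; P] - c ⬝ᵥ A⁻¹.mulVec c ≤ Var[fun ω => X ω - w ⬝ᵥ fun i => Y i ω; P] := by
  have hZ : MemLp (fun ω => X ω - c ⬝ᵥ A⁻¹.mulVec (fun i => Y i ω)) 2 P := memLp_residual hX hY
  have h0 := covariance_residual hX hY hA hdet hc
  rw [← variance_residual hX hY hA hdet hc]
  set Z := fun ω => X ω - c ⬝ᵥ A⁻¹.mulVec (fun i => Y i ω) with hZdef
  -- Pythagoras: any other residual differs from the best one by a combination of the predictors,
  -- which is uncorrelated with it.
  have hsplit : (fun ω => X ω - w ⬝ᵥ fun i => Y i ω) =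
      Z + fun ω => (Matrix.vecMul c A⁻¹ - w) ⬝ᵥ fun i => Y i ω := by
    ext ω
    simp only [hZdef, Pi.add_apply, sub_dotProduct, Matrix.dotProduct_mulVec]
    ring
  rw [hsplit, variance_add hZ (memLp_dotProduct hY _), covariance_dotProduct_right hZ hY]
  simp only [h0, mul_zero, Finset.sum_const_zero, add_zero]
  linarith [variance_nonneg (fun ω => (Matrix.vecMul c A⁻¹ - w) ⬝ᵥ fun i => Y i ω) P]

/-- Residual and predictors are jointly Gaussian, being a linear image of a Gaussian vector, so lack
of correlation is independence. -/
lemma indepFun_residual (hXY : HasGaussianLaw (fun ω => (X ω, fun i => Y i ω)) P)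
    (hA : ∀ i j, cov[Y i, Y j; P] = A i j) (hdet : IsUnit A.det)
    (hc : ∀ i, cov[X, Y i; P] = c i) :
    HasGaussianLaw (fun ω => X ω - c ⬝ᵥ A⁻¹.mulVec (fun i => Y i ω)) P ∧
    IndepFun (fun ω => X ω - c ⬝ᵥ A⁻¹.mulVec (fun i => Y i ω)) (fun ω i => Y i ω) P := by
  have hX : MemLp X 2 P := hXY.fst.memLp_two
  have hY : ∀ i, MemLp (Y i) 2 P := fun i => (hXY.snd.eval i).memLp_two
  let L : (ℝ × (ι → ℝ)) →L[ℝ] (ℝ × (ι → ℝ)) := LinearMap.toContinuousLinearMap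
    { toFun := fun z => (z.1 - c ⬝ᵥ A⁻¹.mulVec z.2, z.2)
      map_add' := fun x y => by
        ext <;> simp [Matrix.mulVec_add, dotProduct_add]; ring
      map_smul' := fun a x => by
        ext <;> simp [Matrix.mulVec_smul, dotProduct_smul, mul_sub] }
  have hZY : HasGaussianLaw
      (fun ω => (X ω - c ⬝ᵥ A⁻¹.mulVec (fun i => Y i ω), fun i => Y i ω)) P := hXY.map L
  refine ⟨hZY.fst, ?_⟩
  have := HasGaussianLaw.indepFun_of_covariance_eval
    (X := fun (_ : Unit) ω => X ω - c ⬝ᵥ A⁻¹.mulVec (fun i => Y i ω)) (Y := Y) (P := P)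
    (hZY.map (((ContinuousLinearMap.pi fun _ : Unit => ContinuousLinearMap.id ℝ ℝ).comp
      (ContinuousLinearMap.fst ℝ ℝ (ι → ℝ))).prod (ContinuousLinearMap.snd ℝ ℝ (ι → ℝ))))
    (fun _ j => covariance_residual hX hY hA hdet hc j)
  exact this.comp (measurable_pi_apply ()) measurable_id

end Regression

/-! ### Covariances and posteriors of the model under a fixed design. -/

section Model

variable {d : ℕ} {Ω : Type*} [MeasurableSpace Ω]

/-- The noisy output of the objective function at the `i`-th point of a deterministic design. -/
def designObs (U : Finset (Finset (Fin d))) (f : FactorProcess d Ω) (ε : ℕ → Ω → ℝ)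
    (q : ℕ → Fin d → ℝ) (i : ℕ) (ω : Ω) : ℝ :=
  objective U f (q i) ω + ε i ω

/-- Together with `IsGaussianFactorModel.singleton`, this lets every result on `postVar` apply to a
factor observed alone. -/
lemma ownPostVar_eq_postVar (k : FactorKernel d) (σ : ℝ) (I : Finset (Fin d)) (t : ℕ)
    (q : ℕ → Fin d → ℝ) (z : Fin d → ℝ) :
    ownPostVar k σ I t q z = postVar k {I} σ I t q z := by
  have : totalCov k {I} = factorCov k I := by ext; simp [totalCov]
  rw [ownPostVar, postVar, this]

namespace IsGaussianFactorModel

variable {P : Measure Ω} {D : Finset (Fin d → ℝ)} {U : Finset (Finset (Fin d))}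
  {k : FactorKernel d} {σ : ℝ} {f : FactorProcess d Ω} {ε : ℕ → Ω → ℝ}

lemma singleton (h : IsGaussianFactorModel P D U k σ f ε) {I : Finset (Fin d)} (hI : I ∈ U) :
    IsGaussianFactorModel P D {I} k σ f ε where
  gaussian J hJ := by obtain rfl := Finset.mem_singleton.1 hJ; exact h.gaussian _ hI
  mean_zero J hJ := by obtain rfl := Finset.mem_singleton.1 hJ; exact h.mean_zero _ hI
  cov_eq J hJ := by obtain rfl := Finset.mem_singleton.1 hJ; exact h.cov_eq _ hI
  indep := h.indep.precomp (g := fun J : ({I} : Finset (Finset (Fin d))) =>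
    (⟨J.1, by rw [Finset.mem_singleton.1 J.2]; exact hI⟩ : U))
    fun a b hab => Subtype.ext (by simpa using hab)
  noise_law := h.noise_law
  noise_indep := h.noise_indep
  noise_indep_factors := by
    have := h.noise_indep_factors.comp
      (φ := fun (g : U × D → ℝ) (p : ({I} : Finset (Finset (Fin d))) × D) =>
        g (⟨p.1.1, by rw [Finset.mem_singleton.1 p.1.2]; exact hI⟩, p.2))
      (ψ := id) (measurable_pi_lambda _ fun p => measurable_pi_apply _) measurable_id
    exact this

lemma memLp_factor (h : IsGaussianFactorModel P D U k σ f ε) {I : Finset (Fin d)} (hI : I ∈ U)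
    {z : Fin d → ℝ} (hz : z ∈ D) : MemLp (f I (I.restrict z)) 2 P :=
  ((h.gaussian I hI).hasGaussianLaw_eval ⟨z, hz⟩).memLp_two

lemma memLp_noise (h : IsGaussianFactorModel P D U k σ f ε) (i : ℕ) : MemLp (ε i) 2 P :=
  (h.noise_law i).hasGaussianLaw.memLp_two

lemma memLp_objective (h : IsGaussianFactorModel P D U k σ f ε) {z : Fin d → ℝ} (hz : z ∈ D) :
    MemLp (objective U f z) 2 P :=
  memLp_finsetSum U fun _ hI => h.memLp_factor hI hz

lemma memLp_designObs (h : IsGaussianFactorModel P D U k σ f ε) {q : ℕ → Fin d → ℝ}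
    (hq : ∀ i, q i ∈ D) (i : ℕ) : MemLp (designObs U f ε q i) 2 P :=
  (h.memLp_objective (hq i)).add (h.memLp_noise i)

lemma integral_designObs (h : IsGaussianFactorModel P D U k σ f ε) [IsProbabilityMeasure P]
    {q : ℕ → Fin d → ℝ} (hq : ∀ i, q i ∈ D) (i : ℕ) : ∫ ω, designObs U f ε q i ω ∂P = 0 := by
  have hε : ∫ ω, ε i ω ∂P = 0 := by rw [(h.noise_law i).integral_eq]; simp
  have hobj : ∫ ω, objective U f (q i) ω ∂P = 0 := by
    simp only [objective]
    rw [integral_finsetSum _ fun I hI => (h.memLp_factor hI (hq i)).integrable one_le_two]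
    exact Finset.sum_eq_zero fun I hI => h.mean_zero I hI _ (hq i)
  simp only [designObs]
  rw [integral_add ((h.memLp_objective (hq i)).integrable one_le_two)
    ((h.memLp_noise i).integrable one_le_two), hobj, hε, add_zero]

lemma covariance_factor_noise (h : IsGaussianFactorModel P D U k σ f ε) [IsProbabilityMeasure P]
    {I : Finset (Fin d)} (hI : I ∈ U) {z : Fin d → ℝ} (hz : z ∈ D) (i : ℕ) :
    cov[f I (I.restrict z), ε i; P] = 0 :=
  (h.noise_indep_factors.comp (φ := fun g : U × D → ℝ => g (⟨I, hI⟩, ⟨z, hz⟩))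
    (ψ := fun g : ℕ → ℝ => g i)
    (measurable_pi_apply _) (measurable_pi_apply _)).covariance_eq_zero
    (h.memLp_factor hI hz) (h.memLp_noise i)

lemma covariance_noise (h : IsGaussianFactorModel P D U k σ f ε) [IsProbabilityMeasure P]
    (i j : ℕ) : cov[ε i, ε j; P] = if i = j then σ ^ 2 else 0 := by
  split_ifs with hij
  · subst hij
    rw [covariance_self (h.memLp_noise i).aemeasurable, (h.noise_law i).variance_eq]
    simp [sq_nonneg]
  · exact (h.noise_indep.indepFun hij).covariance_eq_zero (h.memLp_noise i) (h.memLp_noise j)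

lemma covariance_factor_factor (h : IsGaussianFactorModel P D U k σ f ε) [IsProbabilityMeasure P]
    {I J : Finset (Fin d)} (hI : I ∈ U) (hJ : J ∈ U) {x z : Fin d → ℝ} (hx : x ∈ D) (hz : z ∈ D) :
    cov[f I (I.restrict x), f J (J.restrict z); P] = if I = J then factorCov k I x z else 0 := by
  split_ifs with hIJ
  · subst hIJ
    exact h.cov_eq I hI x hx z hz
  · have hne : (⟨I, hI⟩ : U) ≠ ⟨J, hJ⟩ := fun h => hIJ (congrArg Subtype.val h)
    exact ((h.indep.indepFun hne).comp (φ := fun g : D → ℝ => g ⟨x, hx⟩)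
      (ψ := fun g : D → ℝ => g ⟨z, hz⟩)
      (measurable_pi_apply _) (measurable_pi_apply _)).covariance_eq_zero
      (h.memLp_factor hI hx) (h.memLp_factor hJ hz)

lemma covariance_factor_objective (h : IsGaussianFactorModel P D U k σ f ε)
    [IsProbabilityMeasure P] {I : Finset (Fin d)} (hI : I ∈ U) {x z : Fin d → ℝ} (hx : x ∈ D)
    (hz : z ∈ D) : cov[f I (I.restrict x), objective U f z; P] = factorCov k I x z := by
  have : objective U f z = fun ω => ∑ J ∈ U, f J (J.restrict z) ω := rfl
  rw [this, covariance_fun_sum_right' (fun J hJ => h.memLp_factor hJ hz) (h.memLp_factor hI hx),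
    Finset.sum_congr rfl fun J hJ => h.covariance_factor_factor hI hJ hx hz]
  simp [hI]

lemma covariance_objective (h : IsGaussianFactorModel P D U k σ f ε)
    [IsProbabilityMeasure P] {x z : Fin d → ℝ} (hx : x ∈ D) (hz : z ∈ D) :
    cov[objective U f x, objective U f z; P] = totalCov k U x z := by
  have : objective U f x = fun ω => ∑ J ∈ U, f J (J.restrict x) ω := rfl
  rw [this, covariance_fun_sum_left' (fun J hJ => h.memLp_factor hJ hx) (h.memLp_objective hz),
    Finset.sum_congr rfl fun J hJ => h.covariance_factor_objective hJ hx hz]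
  rfl

lemma covariance_objective_noise (h : IsGaussianFactorModel P D U k σ f ε)
    [IsProbabilityMeasure P] {x : Fin d → ℝ} (hx : x ∈ D) (i : ℕ) :
    cov[objective U f x, ε i; P] = 0 := by
  have : objective U f x = fun ω => ∑ J ∈ U, f J (J.restrict x) ω := rfl
  rw [this, covariance_fun_sum_left' (fun J hJ => h.memLp_factor hJ hx) (h.memLp_noise i)]
  exact Finset.sum_eq_zero fun J hJ => h.covariance_factor_noise hJ hx i

variable {q : ℕ → Fin d → ℝ}

lemma covariance_factor_designObs (h : IsGaussianFactorModel P D U k σ f ε)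
    [IsProbabilityMeasure P] {I : Finset (Fin d)} (hI : I ∈ U) {x : Fin d → ℝ} (hx : x ∈ D)
    (hq : ∀ i, q i ∈ D) (i : ℕ) :
    cov[f I (I.restrict x), designObs U f ε q i; P] = factorCov k I x (q i) := by
  have : designObs U f ε q i = objective U f (q i) + ε i := rfl
  rw [this, covariance_add_right (h.memLp_factor hI hx) (h.memLp_objective (hq i))
    (h.memLp_noise i), h.covariance_factor_objective hI hx (hq i),
    h.covariance_factor_noise hI hx, add_zero]

lemma covariance_noise_designObs (h : IsGaussianFactorModel P D U k σ f ε)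
    [IsProbabilityMeasure P] (hq : ∀ i, q i ∈ D) (i j : ℕ) :
    cov[ε i, designObs U f ε q j; P] = if i = j then σ ^ 2 else 0 := by
  have : designObs U f ε q j = objective U f (q j) + ε j := rfl
  rw [this, covariance_add_right (h.memLp_noise i) (h.memLp_objective (hq j))
    (h.memLp_noise j), covariance_comm, h.covariance_objective_noise (hq j),
    h.covariance_noise, zero_add]

lemma covariance_designObs (h : IsGaussianFactorModel P D U k σ f ε)
    [IsProbabilityMeasure P] (hq : ∀ i, q i ∈ D) {t : ℕ} (i j : Fin t) :
    cov[designObs U f ε q i, designObs U f ε q j; P] = noisyGram (totalCov k U) σ t q i j := by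
  have h1 : designObs U f ε q i = objective U f (q i) + ε i := rfl
  have h2 : designObs U f ε q j = objective U f (q j) + ε j := rfl
  rw [h1, covariance_add_left (h.memLp_objective (hq i)) (h.memLp_noise i)
    (h.memLp_designObs hq j), h.covariance_noise_designObs hq, h2,
    covariance_add_right (h.memLp_objective (hq i)) (h.memLp_objective (hq j))
    (h.memLp_noise j), h.covariance_objective_noise (hq i), h.covariance_objective (hq i) (hq j)]
  simp [noisyGram, Matrix.one_apply, Fin.ext_iff]

/-- The quadratic form at `w` is the variance of the combination of objective values with weights
`w`. -/
lemma posSemidef_gram (h : IsGaussianFactorModel P D U k σ f ε)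
    [IsProbabilityMeasure P] (hq : ∀ i, q i ∈ D) (t : ℕ) :
    (Matrix.of fun i j : Fin t => totalCov k U (q i) (q j)).PosSemidef := by
  refine Matrix.PosSemidef.of_dotProduct_mulVec_nonneg ?_ fun w => ?_
  · ext i j
    simp only [Matrix.conjTranspose_apply, Matrix.of_apply, star_trivial]
    rw [← h.covariance_objective (hq j) (hq i), covariance_comm,
      h.covariance_objective (hq i) (hq j)]
  · have hv := variance_nonneg (fun ω => w ⬝ᵥ fun i : Fin t => objective U f (q i) ω) P
    have hm : ∀ i : Fin t, MemLp (objective U f (q i)) 2 P := fun i => h.memLp_objective (hq i)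
    rw [← covariance_self (memLp_dotProduct hm w).aemeasurable,
      covariance_dotProduct_right (memLp_dotProduct hm w) hm] at hv
    simp_rw [covariance_comm (fun ω => w ⬝ᵥ fun i : Fin t => objective U f (q i) ω),
      covariance_dotProduct_right (hm _) hm w, h.covariance_objective (hq _) (hq _)] at hv
    refine hv.trans_eq ?_
    simp only [dotProduct, Matrix.mulVec, Matrix.of_apply, Pi.star_apply, star_trivial]
    refine Finset.sum_congr rfl fun i _ => ?_
    congr 1
    exact Finset.sum_congr rfl fun j _ => mul_comm _ _

lemma isUnit_det_noisyGram (h : IsGaussianFactorModel P D U k σ f ε)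
    [IsProbabilityMeasure P] (hσ : 0 < σ) (hq : ∀ i, q i ∈ D) (t : ℕ) :
    IsUnit (noisyGram (totalCov k U) σ t q).det := by
  rw [← Matrix.isUnit_iff_isUnit_det]
  exact (Matrix.PosDef.posSemidef_add (h.posSemidef_gram hq t)
    (Matrix.PosDef.one.smul (by positivity))).isUnit

/-- Independence of the Gaussian blocks makes them jointly Gaussian; factor values and outputs under
a fixed design are then linear images of this one vector. -/
lemma hasGaussianLaw_factors_noise (h : IsGaussianFactorModel P D U k σ f ε) (n : ℕ) :
    HasGaussianLaw (fun ω => ((fun (I : U) (x : D) => f I.1 (I.1.restrict x.1) ω),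
      fun i : Fin n => ε i ω)) P := by
  refine IndepFun.hasGaussianLaw ?_ ?_ ?_
  · refine iIndepFun.hasGaussianLaw (X := fun (I : U) ω (x : D) => f I.1 (I.1.restrict x.1) ω)
      (fun I => ?_) h.indep
    exact ((h.gaussian I.1 I.2).hasGaussianLaw Finset.univ).map
      (ContinuousLinearMap.pi fun x : D =>
        ContinuousLinearMap.proj (⟨x, Finset.mem_univ x⟩ : (Finset.univ : Finset D)))
  · exact iIndepFun.hasGaussianLaw (X := fun (i : Fin n) ω => ε i ω)
      (fun i => (h.noise_law i).hasGaussianLaw) (h.noise_indep.precomp Fin.val_injective)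
  · exact h.noise_indep_factors.comp (φ := fun g (I : U) (x : D) => g (I, x))
      (ψ := fun g (i : Fin n) => g i)
      (measurable_pi_lambda _ fun I => measurable_pi_lambda _ fun x => measurable_pi_apply _)
      (measurable_pi_lambda _ fun i => measurable_pi_apply _)

lemma hasGaussianLaw_factor_designObs (h : IsGaussianFactorModel P D U k σ f ε)
    (hq : ∀ i, q i ∈ D) (t : ℕ) {I : Finset (Fin d)} (hI : I ∈ U) {z : Fin d → ℝ} (hz : z ∈ D) :
    HasGaussianLaw (fun ω => (f I (I.restrict z) ω, fun i : Fin t => designObs U f ε q i ω)) P := by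
  let L : ((U → D → ℝ) × (Fin t → ℝ)) →L[ℝ] (ℝ × (Fin t → ℝ)) := LinearMap.toContinuousLinearMap
    { toFun := fun w => (w.1 ⟨I, hI⟩ ⟨z, hz⟩, fun i => ∑ J : U, w.1 J ⟨q i, hq i⟩ + w.2 i)
      map_add' := fun x y => by
        ext
        · simp
        · simp [Finset.sum_add_distrib]; ring
      map_smul' := fun a x => by
        ext
        · simp
        · simp [Finset.mul_sum, mul_add] }
  have hL : (fun ω => (f I (I.restrict z) ω, fun i : Fin t => designObs U f ε q i ω)) =
      L ∘ fun ω => ((fun (I : U) (x : D) => f I.1 (I.1.restrict x.1) ω), fun i : Fin t => ε i ω) := by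
    funext ω
    refine Prod.ext rfl (funext fun i => ?_)
    exact congrArg (· + ε i ω) (Finset.sum_coe_sort U fun J => f J (J.restrict (q i)) ω).symm
  rw [hL]
  exact (h.hasGaussianLaw_factors_noise t).map L

lemma variance_factor (h : IsGaussianFactorModel P D U k σ f ε) {I : Finset (Fin d)} (hI : I ∈ U)
    {z : Fin d → ℝ} (hz : z ∈ D) : Var[f I (I.restrict z); P] = factorCov k I z z := by
  rw [← covariance_self (h.memLp_factor hI hz).aemeasurable]
  exact h.cov_eq I hI z hz z hz

variable [IsProbabilityMeasure P]

lemma variance_sub_postMean (h : IsGaussianFactorModel P D U k σ f ε) (hσ : 0 < σ)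
    (hq : ∀ i, q i ∈ D) (t : ℕ) {I : Finset (Fin d)} (hI : I ∈ U) {z : Fin d → ℝ} (hz : z ∈ D) :
    Var[fun ω => f I (I.restrict z) ω -
      postMean k U σ I t q (fun i => designObs U f ε q i ω) z; P] = postVar k U σ I t q z := by
  rw [postVar, ← h.variance_factor hI hz]
  exact variance_residual (Y := fun (i : Fin t) => designObs U f ε q i) (h.memLp_factor hI hz)
    (fun i => h.memLp_designObs hq i)
    (fun i j => h.covariance_designObs hq i j) (h.isUnit_det_noisyGram hσ hq t)
    (fun i => h.covariance_factor_designObs hI hz hq i)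

lemma postVar_nonneg (h : IsGaussianFactorModel P D U k σ f ε) (hσ : 0 < σ)
    (hq : ∀ i, q i ∈ D) (t : ℕ) {I : Finset (Fin d)} (hI : I ∈ U) {z : Fin d → ℝ} (hz : z ∈ D) :
    0 ≤ postVar k U σ I t q z := by
  rw [← h.variance_sub_postMean hσ hq t hI hz]
  exact variance_nonneg _ _

/-- Any weights yield an upper bound; averaging the outputs at one input gives
`ownPostVar_le_div_card`. -/
lemma postVar_le (h : IsGaussianFactorModel P D U k σ f ε) (hσ : 0 < σ)
    (hq : ∀ i, q i ∈ D) (t : ℕ) {I : Finset (Fin d)} (hI : I ∈ U) {z : Fin d → ℝ} (hz : z ∈ D)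
    (w : Fin t → ℝ) :
    postVar k U σ I t q z ≤
      Var[fun ω => f I (I.restrict z) ω - w ⬝ᵥ fun i : Fin t => designObs U f ε q i ω; P] := by
  rw [postVar, ← h.variance_factor hI hz]
  exact variance_residual_le (Y := fun (i : Fin t) => designObs U f ε q i) (h.memLp_factor hI hz)
    (fun i => h.memLp_designObs hq i)
    (fun i j => h.covariance_designObs hq i j) (h.isUnit_det_noisyGram hσ hq t)
    (fun i => h.covariance_factor_designObs hI hz hq i) w

lemma covariance_sub_postMean (h : IsGaussianFactorModel P D U k σ f ε) (hσ : 0 < σ)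
    (hq : ∀ i, q i ∈ D) {t : ℕ} {I : Finset (Fin d)} (hI : I ∈ U) {z : Fin d → ℝ} (hz : z ∈ D)
    {j : ℕ} (hj : j < t) :
    cov[fun ω => f I (I.restrict z) ω -
      postMean k U σ I t q (fun i => designObs U f ε q i ω) z, designObs U f ε q j; P] = 0 :=
  covariance_residual (Y := fun (i : Fin t) => designObs U f ε q i) (h.memLp_factor hI hz)
    (fun i => h.memLp_designObs hq i)
    (fun i j => h.covariance_designObs hq i j) (h.isUnit_det_noisyGram hσ hq t)
    (fun i => h.covariance_factor_designObs hI hz hq i) ⟨j, hj⟩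

lemma integral_sub_postMean (h : IsGaussianFactorModel P D U k σ f ε)
    (hq : ∀ i, q i ∈ D) (t : ℕ) {I : Finset (Fin d)} (hI : I ∈ U) {z : Fin d → ℝ} (hz : z ∈ D) :
    ∫ ω, (f I (I.restrict z) ω - postMean k U σ I t q (fun i => designObs U f ε q i ω) z) ∂P = 0 := by
  simp only [postMean, Matrix.dotProduct_mulVec]
  simp only [dotProduct]
  have hInt : ∀ i : Fin t, Integrable (designObs U f ε q i) P := fun i =>
    (h.memLp_designObs hq i).integrable one_le_two
  rw [integral_sub ((h.memLp_factor hI hz).integrable one_le_two)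
    (integrable_finsetSum _ fun i _ => (hInt i).const_mul _), h.mean_zero I hI z hz,
    integral_finsetSum _ fun i _ => (hInt i).const_mul _]
  simp [integral_const_mul, h.integral_designObs hq]

/-- The posterior error of a factor under a deterministic design is a centred Gaussian variable
with the posterior variance. -/
lemma hasLaw_sub_postMean (h : IsGaussianFactorModel P D U k σ f ε) (hσ : 0 < σ)
    (hq : ∀ i, q i ∈ D) (t : ℕ) {I : Finset (Fin d)} (hI : I ∈ U) {z : Fin d → ℝ} (hz : z ∈ D) :
    HasLaw (fun ω => f I (I.restrict z) ω -
      postMean k U σ I t q (fun i => designObs U f ε q i ω) z)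
      (gaussianReal 0 (postVar k U σ I t q z).toNNReal) P := by
  have hG := (indepFun_residual (h.hasGaussianLaw_factor_designObs hq t hI hz)
    (fun i j => h.covariance_designObs hq i j) (h.isUnit_det_noisyGram hσ hq t)
    (fun i => h.covariance_factor_designObs hI hz hq i)).1
  refine ⟨hG.aemeasurable, ?_⟩
  rw [← h.variance_sub_postMean hσ hq t hI hz, ← h.integral_sub_postMean (σ := σ) hq t hI hz]
  exact hG.map_eq_gaussianReal

/-- The posterior error of a factor under a deterministic design is independent of the
observations. -/
lemma indepFun_sub_postMean (h : IsGaussianFactorModel P D U k σ f ε) (hσ : 0 < σ)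
    (hq : ∀ i, q i ∈ D) (t : ℕ) {I : Finset (Fin d)} (hI : I ∈ U) {z : Fin d → ℝ} (hz : z ∈ D) :
    IndepFun (fun ω => f I (I.restrict z) ω -
      postMean k U σ I t q (fun i => designObs U f ε q i ω) z)
      (fun ω (i : Fin t) => designObs U f ε q i ω) P :=
  (indepFun_residual (h.hasGaussianLaw_factor_designObs hq t hI hz)
    (fun i j => h.covariance_designObs hq i j) (h.isUnit_det_noisyGram hσ hq t)
    (fun i => h.covariance_factor_designObs hI hz hq i)).2

end IsGaussianFactorModel

end Model

/-! ### Confidence bounds under adaptive queries. -/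

section Confidence

variable {d : ℕ}

/-- Posterior quantities after `t` observations see only the first `t` queries, so on the event of
following a design the adaptive queries can be replaced by it. -/
lemma crossCov_congr (k : FactorKernel d) (I : Finset (Fin d)) {t : ℕ} {q q' : ℕ → Fin d → ℝ}
    (hq : ∀ i < t, q i = q' i) (z : Fin d → ℝ) : crossCov k I t q z = crossCov k I t q' z := by
  ext i
  simp [crossCov, hq i i.2]

lemma noisyGram_congr (c : (Fin d → ℝ) → (Fin d → ℝ) → ℝ) (σ : ℝ) {t : ℕ} {q q' : ℕ → Fin d → ℝ}
    (hq : ∀ i < t, q i = q' i) : noisyGram c σ t q = noisyGram c σ t q' := by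
  ext i j
  simp [noisyGram, hq i i.2, hq j j.2]

lemma postVar_congr (k : FactorKernel d) (U : Finset (Finset (Fin d))) (σ : ℝ)
    (I : Finset (Fin d)) {t : ℕ} {q q' : ℕ → Fin d → ℝ} (hq : ∀ i < t, q i = q' i)
    (z : Fin d → ℝ) : postVar k U σ I t q z = postVar k U σ I t q' z := by
  rw [postVar, postVar, crossCov_congr k I hq, noisyGram_congr _ σ hq]

lemma postMean_congr (k : FactorKernel d) (U : Finset (Finset (Fin d))) (σ : ℝ)
    (I : Finset (Fin d)) {t : ℕ} {q q' : ℕ → Fin d → ℝ} (hq : ∀ i < t, q i = q' i)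
    {y y' : ℕ → ℝ} (hy : ∀ i < t, y i = y' i) (z : Fin d → ℝ) :
    postMean k U σ I t q y z = postMean k U σ I t q' y' z := by
  have : (fun i : Fin t => y i) = fun i : Fin t => y' i := funext fun i => hy i i.2
  rw [postMean, postMean, crossCov_congr k I hq, noisyGram_congr _ σ hq, this]

variable {Ω : Type*}
  {D : Finset (Fin d → ℝ)} {U : Finset (Finset (Fin d))}
  {k : FactorKernel d} {σ δ : ℝ} {f : FactorProcess d Ω} {ε : ℕ → Ω → ℝ} {x : ℕ → Ω → Fin d → ℝ}

/-- Extension of a finite design to an infinite one. -/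
def extendDesign {t : ℕ} (q : Fin t → D) (z : Fin d → ℝ) (i : ℕ) : Fin d → ℝ :=
  if hi : i < t then (q ⟨i, hi⟩).1 else z

lemma extendDesign_mem {t : ℕ} (q : Fin t → D) {z : Fin d → ℝ} (hz : z ∈ D) (i : ℕ) :
    extendDesign q z i ∈ D := by
  rw [extendDesign]
  split_ifs with hi
  · exact (q ⟨i, hi⟩).2
  · exact hz

lemma extendDesign_of_lt {t : ℕ} (q : Fin t → D) (z : Fin d → ℝ) {i : ℕ} (hi : i < t) :
    extendDesign q z i = (q ⟨i, hi⟩).1 := dif_pos hi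

/-- The event that an adaptive algorithm follows a given design is an event of the observations
under that design. -/
lemma exists_measurableSet_follows_iff (halg : IsDecHBO D U k σ δ f ε x) {t : ℕ}
    (q : ℕ → Fin d → ℝ) :
    ∃ S : Set (Fin t → ℝ), MeasurableSet S ∧ ∀ ω,
      (∀ i < t, x i ω = q i) ↔ (fun i : Fin t => designObs U f ε q i ω) ∈ S := by
  choose s hs hxs using halg.nonanticipating
  refine ⟨{y | ∀ i : Fin t, s i (fun j : Fin i => y ⟨j, j.2.trans i.2⟩) = q i}, ?_, fun ω => ?_⟩
  · rw [Set.ofPred_forall]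
    refine MeasurableSet.iInter fun i => ?_
    have hm : Measurable fun y : Fin t → ℝ =>
        s i (fun j : Fin i => y ⟨j, j.2.trans i.2⟩) :=
      (hs i).comp (measurable_pi_lambda _ fun j => measurable_pi_apply _)
    exact hm (measurableSet_singleton (q i))
  · constructor
    · intro hx i
      rw [← hx i i.2, hxs i ω]
      congr 1
      ext j
      simp only [designObs, observation, hx j (j.2.trans i.2)]
    -- Once the earlier queries agree with the design, so do the outputs that determine the next
    -- query.
    · intro hy i
      induction i using Nat.strong_induction_on with
      | _ i ih =>
        intro hi
        rw [← hy ⟨i, hi⟩, hxs i ω]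
        congr 1
        ext j
        simp only [designObs, observation, ih j j.2 (j.2.trans hi)]

variable [MeasurableSpace Ω] {P : Measure Ω} [IsProbabilityMeasure P]

/-- Although the queries are adaptive, the posterior mean of a factor deviates from its value with
the Gaussian tail probability. -/
lemma measure_postMean_deviation_le (h : IsGaussianFactorModel P D U k σ f ε) (hσ : 0 < σ)
    (halg : IsDecHBO D U k σ δ f ε x) (t : ℕ) {I : Finset (Fin d)} (hI : I ∈ U)
    {z : Fin d → ℝ} (hz : z ∈ D) {β : ℝ} (hβ : 0 ≤ β) :
    P {ω | √β * √(postVar k U σ I t (fun i => x i ω) z) <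
      |f I (I.restrict z) ω -
        postMean k U σ I t (fun i => x i ω) (fun i => observation U f ε x i ω) z|} ≤
      ENNReal.ofReal (Real.exp (-β / 2)) := by
  set B := {ω | √β * √(postVar k U σ I t (fun i => x i ω) z) <
      |f I (I.restrict z) ω -
        postMean k U σ I t (fun i => x i ω) (fun i => observation U f ε x i ω) z|} with hB
  -- The sample space is split by the realized design; the values beyond `t` are immaterial, and `z`
  -- merely keeps them in `D`.
  let A : (Fin t → D) → Set Ω := fun q => {ω | ∀ i < t, x i ω = extendDesign q z i}
  have hAm : ∀ q, NullMeasurableSet (A q) P := fun q => by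
    obtain ⟨S, hS, hiff⟩ := exists_measurableSet_follows_iff halg (t := t) (extendDesign q z)
    have hA : A q = (fun ω (i : Fin t) => designObs U f ε (extendDesign q z) i ω) ⁻¹' S := by
      ext ω; exact hiff ω
    rw [hA]
    have hY : AEMeasurable (fun ω (i : Fin t) => designObs U f ε (extendDesign q z) i ω) P :=
      aemeasurable_pi_lambda _ fun i => (h.memLp_designObs (extendDesign_mem q hz) i).aemeasurable
    exact hY.nullMeasurableSet_preimage hS
  have hAd : Pairwise (Function.onFun (AEDisjoint P) A) := fun q q' hqq' => by
    refine Disjoint.aedisjoint (Set.disjoint_left.2 fun ω hω hω' => hqq' (funext fun i => ?_))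
    have := (hω i i.2).symm.trans (hω' i i.2)
    rw [extendDesign_of_lt _ _ i.2, extendDesign_of_lt _ _ i.2] at this
    exact Subtype.ext this
  have hcover : B ⊆ ⋃ q, B ∩ A q := fun ω hω => by
    refine Set.mem_iUnion.2 ⟨fun i => ⟨x i ω, halg.mem i ω⟩, hω, fun i hi => ?_⟩
    rw [extendDesign_of_lt _ _ hi]
  have hpiece : ∀ q, P (B ∩ A q) ≤ ENNReal.ofReal (Real.exp (-β / 2)) * P (A q) := fun q => by
    have hqD := extendDesign_mem q hz
    obtain ⟨S, hS, hiff⟩ := exists_measurableSet_follows_iff halg (t := t) (extendDesign q z)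
    have hA : A q = (fun ω (i : Fin t) => designObs U f ε (extendDesign q z) i ω) ⁻¹' S := by
      ext ω; exact hiff ω
    set V := postVar k U σ I t (extendDesign q z) z with hV
    set Z := fun ω => f I (I.restrict z) ω - postMean k U σ I t (extendDesign q z)
      (fun i => designObs U f ε (extendDesign q z) i ω) z with hZ
    have hT : MeasurableSet {r : ℝ | √β * √(V.toNNReal : ℝ) < |r|} :=
      measurableSet_lt measurable_const (by fun_prop)
    have hV0 : 0 ≤ V := h.postVar_nonneg hσ hqD t hI hz
    have hsub : B ∩ A q ⊆ Z ⁻¹' {r : ℝ | √β * √(V.toNNReal : ℝ) < |r|} ∩ A q := by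
      rintro ω ⟨hω, hωA⟩
      refine ⟨?_, hωA⟩
      have hobs : ∀ i < t, observation U f ε x i ω = designObs U f ε (extendDesign q z) i ω :=
        fun i hi => by simp only [designObs, observation, hωA i hi]
      simp only [hB, Set.mem_ofPred_eq] at hω
      rw [postVar_congr k U σ I hωA z, postMean_congr k U σ I hωA hobs z] at hω
      simpa [hZ, Real.coe_toNNReal _ hV0] using hω
    have hind : IndepFun Z (fun ω (i : Fin t) => designObs U f ε (extendDesign q z) i ω) P :=
      h.indepFun_sub_postMean hσ hqD t hI hz
    have hlaw : HasLaw Z (gaussianReal 0 V.toNNReal) P := h.hasLaw_sub_postMean hσ hqD t hI hz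
    calc P (B ∩ A q) ≤ P (Z ⁻¹' {r : ℝ | √β * √(V.toNNReal : ℝ) < |r|} ∩ A q) :=
          measure_mono hsub
      _ = P (Z ⁻¹' {r : ℝ | √β * √(V.toNNReal : ℝ) < |r|}) * P (A q) := by
          -- The posterior error under the design is independent of its outputs, hence of the event
          -- that the design is followed.
          rw [hA]; exact hind.measure_inter_preimage_eq_mul _ _ hT hS
      _ ≤ _ := by
          gcongr
          rw [← Measure.map_apply_of_aemeasurable hlaw.aemeasurable hT, hlaw.map_eq]
          exact gaussianReal_abs_gt_le _ hβ
  calc P B ≤ P (⋃ q, B ∩ A q) := measure_mono hcover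
    _ ≤ ∑ q, P (B ∩ A q) := measure_iUnion_fintype_le _ _
    _ ≤ ∑ q, ENNReal.ofReal (Real.exp (-β / 2)) * P (A q) := Finset.sum_le_sum fun q _ => hpiece q
    _ = ENNReal.ofReal (Real.exp (-β / 2)) * P (⋃ q, A q) := by
        rw [← Finset.mul_sum, measure_iUnion₀ hAd hAm, tsum_fintype]
    _ ≤ _ := mul_le_of_le_one_right' prob_le_one

variable (D U δ) in
lemma beta_nonneg (hD : D.Nonempty) (hU : U.Nonempty) (hδ : 0 < δ) (hδ1 : δ < 1) (t : ℕ) :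
    0 ≤ beta D U δ (t + 1) := by
  have hD1 : (1 : ℝ) ≤ D.card := by exact_mod_cast hD.card_pos
  have hU1 : (1 : ℝ) ≤ U.card := by exact_mod_cast hU.card_pos
  have ht1 : (1 : ℝ) ≤ (t + 1 : ℕ) := by exact_mod_cast Nat.succ_pos t
  have hpi : (1 : ℝ) ≤ Real.pi ^ 2 * ((t + 1 : ℕ) : ℝ) ^ 2 / 6 := by
    rw [le_div_iff₀ (by norm_num)]
    have h3 : 9 ≤ Real.pi ^ 2 := by nlinarith [Real.pi_gt_three]
    have : (1 : ℝ) ≤ ((t + 1 : ℕ) : ℝ) ^ 2 := one_le_pow₀ ht1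
    nlinarith
  refine mul_nonneg zero_le_two (Real.log_nonneg ?_)
  rw [one_le_div hδ]
  exact hδ1.le.trans (one_le_mul_of_one_le_of_one_le
    (one_le_mul_of_one_le_of_one_le hD1 hU1) hpi)

lemma exp_neg_beta_div_two (hD : D.Nonempty) (hU : U.Nonempty) (hδ : 0 < δ) (t : ℕ) :
    Real.exp (-beta D U δ (t + 1) / 2) =
      δ / (D.card * U.card) * (6 / Real.pi ^ 2 * (1 / ((t + 1 : ℕ) : ℝ) ^ 2)) := by
  have hD1 : (0 : ℝ) < D.card := by exact_mod_cast hD.card_pos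
  have hU1 : (0 : ℝ) < U.card := by exact_mod_cast hU.card_pos
  have ht1 : (0 : ℝ) < (t + 1 : ℕ) := by exact_mod_cast Nat.succ_pos t
  have hpi := Real.pi_pos
  rw [beta, neg_div, mul_div_cancel_left₀ _ two_ne_zero, ← Real.log_inv,
    Real.exp_log (by positivity)]
  field_simp

/-- With probability at least `1 - δ`, the posterior means of all factors lie within the confidence
radius of their values, at all times and all inputs. -/
lemma exists_confidence_event (h : IsGaussianFactorModel P D U k σ f ε) (hσ : 0 < σ)
    (hD : D.Nonempty) (hδ : 0 < δ) (hδ1 : δ < 1) (halg : IsDecHBO D U k σ δ f ε x) :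
    ∃ E : Set Ω, MeasurableSet E ∧ ENNReal.ofReal (1 - δ) ≤ P E ∧ ∀ ω ∈ E, ∀ t, ∀ I ∈ U, ∀ z ∈ D,
      |f I (I.restrict z) ω -
        postMean k U σ I t (fun i => x i ω) (fun i => observation U f ε x i ω) z| ≤
      √(beta D U δ (t + 1)) * √(postVar k U σ I t (fun i => x i ω) z) := by
  -- Without factors the claim is vacuous; the union bound below divides by `U.card`.
  rcases U.eq_empty_or_nonempty with rfl | hU
  · exact ⟨Set.univ, .univ, by simpa using hδ.le, by simp⟩
  let bad : ℕ → Finset (Fin d) → (Fin d → ℝ) → Set Ω := fun t I z =>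
    {ω | √(beta D U δ (t + 1)) * √(postVar k U σ I t (fun i => x i ω) z) <
      |f I (I.restrict z) ω -
        postMean k U σ I t (fun i => x i ω) (fun i => observation U f ε x i ω) z|}
  let B : Set Ω := ⋃ t : ℕ, ⋃ I ∈ U, ⋃ z ∈ D, bad t I z
  have hc0 : (0 : ℝ) ≤ δ / (D.card * U.card) := by positivity
  -- The Basel sum. The index shift loses only the term at 0, which is `1 / 0 ^ 2 = 0`.
  have hsum : HasSum (fun t : ℕ => δ * (6 / Real.pi ^ 2 * (1 / ((t + 1 : ℕ) : ℝ) ^ 2))) δ := by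
    have h1 := (hasSum_nat_add_iff' 1).2 hasSum_zeta_two
    have h2 := (h1.mul_left (6 / Real.pi ^ 2)).mul_left δ
    have hpi := Real.pi_pos.ne'
    convert! h2 using 1
    simp [hpi]
  have hPB : P B ≤ ENNReal.ofReal δ := by
    calc P B ≤ ∑' t : ℕ, P (⋃ I ∈ U, ⋃ z ∈ D, bad t I z) := measure_iUnion_le _
      _ ≤ ∑' t : ℕ, ENNReal.ofReal (δ * (6 / Real.pi ^ 2 * (1 / ((t + 1 : ℕ) : ℝ) ^ 2))) := by
          refine ENNReal.tsum_le_tsum fun t => ?_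
          calc P (⋃ I ∈ U, ⋃ z ∈ D, bad t I z)
              ≤ ∑ I ∈ U, ∑ z ∈ D, P (bad t I z) :=
                (measure_biUnion_finset_le _ _).trans
                  (Finset.sum_le_sum fun I _ => measure_biUnion_finset_le _ _)
            _ ≤ ∑ I ∈ U, ∑ z ∈ D, ENNReal.ofReal (Real.exp (-beta D U δ (t + 1) / 2)) :=
                Finset.sum_le_sum fun I hI => Finset.sum_le_sum fun z hz =>
                  measure_postMean_deviation_le h hσ halg t hI hz
                    (beta_nonneg D U δ hD hU hδ hδ1 t)
            _ = _ := by
                have hD1 : (0 : ℝ) < D.card := by exact_mod_cast hD.card_pos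
                have hU1 : (0 : ℝ) < U.card := by exact_mod_cast hU.card_pos
                rw [exp_neg_beta_div_two hD hU hδ]
                simp only [Finset.sum_const, nsmul_eq_mul]
                rw [← ENNReal.ofReal_natCast, ← ENNReal.ofReal_natCast,
                  ← ENNReal.ofReal_mul hD1.le, ← ENNReal.ofReal_mul hU1.le]
                congr 1
                field_simp
      _ = ENNReal.ofReal δ := by
          rw [← ENNReal.ofReal_tsum_of_nonneg (fun t => by positivity) hsum.summable, hsum.tsum_eq]
  -- The model makes the factors only a.e. measurable, so the bad set is enlarged to a measurable
  -- hull of equal probability.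
  refine ⟨(toMeasurable P B)ᶜ, (measurableSet_toMeasurable P B).compl, ?_, fun ω hω t I hI z hz => ?_⟩
  · rw [prob_compl_eq_one_sub (measurableSet_toMeasurable P B), measure_toMeasurable,
      ENNReal.ofReal_sub _ hδ.le, ENNReal.ofReal_one]
    exact tsub_le_tsub_left hPB 1
  · by_contra hlt
    refine hω (subset_toMeasurable P B ?_)
    simp only [B, Set.mem_iUnion]
    exact ⟨t, I, hI, z, hz, not_le.1 hlt⟩

end Confidence

/-! ### Innovations and the information gain of a design. -/

section InformationGain

variable {d : ℕ}

/-- The weight of the `j`-th observation in the posterior mean after `t` observations, extended by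
zero to `j ≥ t`. -/
def postWeight (k : FactorKernel d) (U : Finset (Finset (Fin d))) (σ : ℝ) (I : Finset (Fin d))
    (t : ℕ) (q : ℕ → Fin d → ℝ) (z : Fin d → ℝ) (j : ℕ) : ℝ :=
  if hj : j < t then
    Matrix.vecMul (crossCov k I t q z) (noisyGram (totalCov k U) σ t q)⁻¹ ⟨j, hj⟩ else 0

lemma postWeight_of_le (k : FactorKernel d) (U : Finset (Finset (Fin d))) (σ : ℝ)
    (I : Finset (Fin d)) {t : ℕ} (q : ℕ → Fin d → ℝ) (z : Fin d → ℝ) {j : ℕ} (hj : t ≤ j) :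
    postWeight k U σ I t q z j = 0 := dif_neg (not_lt.2 hj)

lemma postMean_eq_sum_postWeight (k : FactorKernel d) (U : Finset (Finset (Fin d))) (σ : ℝ)
    (I : Finset (Fin d)) {t n : ℕ} (htn : t ≤ n) (q : ℕ → Fin d → ℝ) (y : ℕ → ℝ)
    (z : Fin d → ℝ) :
    postMean k U σ I t q y z = ∑ j : Fin n, postWeight k U σ I t q z j * y j := by
  rw [Fin.sum_univ_eq_sum_range (fun j => postWeight k U σ I t q z j * y j) n,
    ← Finset.sum_subset (Finset.range_subset_range.2 htn) (fun j _ hj => by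
      rw [postWeight_of_le k U σ I q z (by simpa using hj), zero_mul]),
    ← Fin.sum_univ_eq_sum_range (fun j => postWeight k U σ I t q z j * y j) t,
    postMean, Matrix.dotProduct_mulVec, dotProduct]
  exact Finset.sum_congr rfl fun i _ => by simp [postWeight]

/-- The unit lower triangular matrix that maps the observations of a factor to its innovations. -/
def innovationMatrix (k : FactorKernel d) (U : Finset (Finset (Fin d))) (σ : ℝ)
    (I : Finset (Fin d)) (n : ℕ) (q : ℕ → Fin d → ℝ) : Matrix (Fin n) (Fin n) ℝ :=
  1 - Matrix.of fun i j : Fin n => postWeight k U σ I i q (q i) j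

/-- The `i`-th prediction uses only outputs `j < i`, so the matrix is triangular with ones on the
diagonal. -/
lemma det_innovationMatrix (k : FactorKernel d) (U : Finset (Finset (Fin d))) (σ : ℝ)
    (I : Finset (Fin d)) (n : ℕ) (q : ℕ → Fin d → ℝ) :
    (innovationMatrix k U σ I n q).det = 1 := by
  rw [Matrix.det_of_isLowerTriangular]
  · refine Finset.prod_eq_one fun i _ => ?_
    simp [innovationMatrix, postWeight_of_le k U σ I q (q i) le_rfl]
  · intro i j hij
    have hij : i < j := hij
    simp [innovationMatrix, hij.ne, postWeight_of_le k U σ I q (q i) (Fin.le_def.1 hij.le)]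

lemma innovationMatrix_mulVec (k : FactorKernel d) (U : Finset (Finset (Fin d))) (σ : ℝ)
    (I : Finset (Fin d)) {n : ℕ} (q : ℕ → Fin d → ℝ) (y : ℕ → ℝ) (i : Fin n) :
    (innovationMatrix k U σ I n q).mulVec (fun j : Fin n => y j) i =
      y i - postMean k U σ I i q y (q i) := by
  rw [innovationMatrix, Matrix.sub_mulVec, Matrix.one_mulVec, Pi.sub_apply,
    postMean_eq_sum_postWeight k U σ I i.2.le]
  rfl

variable {Ω : Type*}

lemma designObs_singleton (I : Finset (Fin d)) (f : FactorProcess d Ω) (ε : ℕ → Ω → ℝ)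
    (q : ℕ → Fin d → ℝ) (i : ℕ) :
    designObs {I} f ε q i = fun ω => f I (I.restrict (q i)) ω + ε i ω := by
  ext; simp [designObs, objective]

/-- The innovation of the observations of a single factor. -/
lemma innovation_eq (I : Finset (Fin d)) (k : FactorKernel d) (σ : ℝ) (f : FactorProcess d Ω)
    (ε : ℕ → Ω → ℝ) (q : ℕ → Fin d → ℝ) (i : ℕ) :
    (fun ω => designObs {I} f ε q i ω -
      postMean k {I} σ I i q (fun j => designObs {I} f ε q j ω) (q i)) =
    (fun ω => f I (I.restrict (q i)) ω -
      postMean k {I} σ I i q (fun j => designObs {I} f ε q j ω) (q i)) + ε i := by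
  ext ω
  simp only [Pi.add_apply]
  rw [designObs_singleton]
  ring

variable [MeasurableSpace Ω] {P : Measure Ω} {D : Finset (Fin d → ℝ)} {U : Finset (Finset (Fin d))}
  {k : FactorKernel d} {σ s : ℝ} {f : FactorProcess d Ω} {ε : ℕ → Ω → ℝ} {q : ℕ → Fin d → ℝ}

namespace IsGaussianFactorModel

lemma memLp_postMean (h : IsGaussianFactorModel P D U k σ f ε) (hq : ∀ i, q i ∈ D)
    (I : Finset (Fin d)) (t : ℕ) (z : Fin d → ℝ) :
    MemLp (fun ω => postMean k U σ I t q (fun i => designObs U f ε q i ω) z) 2 P := by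
  simp only [postMean, Matrix.dotProduct_mulVec]
  exact memLp_dotProduct (Y := fun i : Fin t => designObs U f ε q i)
    (fun i => h.memLp_designObs hq i) _

lemma memLp_sub_postMean (h : IsGaussianFactorModel P D U k σ f ε)
    (hq : ∀ i, q i ∈ D) (t : ℕ) {I : Finset (Fin d)} (hI : I ∈ U) {z : Fin d → ℝ} (hz : z ∈ D) :
    MemLp (fun ω => f I (I.restrict z) ω -
      postMean k U σ I t q (fun i => designObs U f ε q i ω) z) 2 P :=
  (h.memLp_factor hI hz).sub (h.memLp_postMean hq I t z)

variable [IsProbabilityMeasure P]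

/-- With indices from 0, the posterior mean after `t` observations involves only the noises `0, …, t
- 1`. -/
lemma covariance_noise_postMean (h : IsGaussianFactorModel P D U k σ f ε) (hq : ∀ i, q i ∈ D)
    (I : Finset (Fin d)) (t : ℕ) (z : Fin d → ℝ) :
    cov[ε t, fun ω => postMean k U σ I t q (fun i => designObs U f ε q i ω) z; P] = 0 := by
  simp only [postMean, Matrix.dotProduct_mulVec]
  rw [covariance_dotProduct_right (Y := fun i : Fin t => designObs U f ε q i) (h.memLp_noise t)
    (fun i => h.memLp_designObs hq i)]
  refine Finset.sum_eq_zero fun i _ => ?_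
  rw [h.covariance_noise_designObs hq, if_neg i.2.ne', mul_zero]

lemma covariance_innovation_designObs {I : Finset (Fin d)}
    (h : IsGaussianFactorModel P D {I} k σ f ε) (hσ : 0 < σ) (hq : ∀ i, q i ∈ D) {i j : ℕ}
    (hji : j < i) :
    cov[fun ω => designObs {I} f ε q i ω -
      postMean k {I} σ I i q (fun j => designObs {I} f ε q j ω) (q i),
      designObs {I} f ε q j; P] = 0 := by
  have hI := Finset.mem_singleton_self I
  rw [innovation_eq, covariance_add_left (h.memLp_sub_postMean hq i hI (hq i)) (h.memLp_noise i)
    (h.memLp_designObs hq j), h.covariance_sub_postMean hσ hq hI (hq i) hji,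
    h.covariance_noise_designObs hq, if_neg hji.ne', add_zero]

lemma variance_innovation {I : Finset (Fin d)}
    (h : IsGaussianFactorModel P D {I} k σ f ε) (hσ : 0 < σ) (hq : ∀ i, q i ∈ D) (i : ℕ) :
    Var[fun ω => designObs {I} f ε q i ω -
      postMean k {I} σ I i q (fun j => designObs {I} f ε q j ω) (q i); P] =
      postVar k {I} σ I i q (q i) + σ ^ 2 := by
  have hI := Finset.mem_singleton_self I
  have hZ := h.memLp_sub_postMean hq i hI (hq i)
  have hcov : cov[fun ω => f I (I.restrict (q i)) ω -
      postMean k {I} σ I i q (fun j => designObs {I} f ε q j ω) (q i), ε i; P] = 0 := by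
    rw [covariance_fun_sub_left (h.memLp_factor hI (hq i)) (h.memLp_postMean hq I i (q i))
      (h.memLp_noise i), h.covariance_factor_noise hI (hq i), covariance_comm,
      h.covariance_noise_postMean hq, sub_zero]
  rw [innovation_eq, variance_add hZ (h.memLp_noise i), hcov,
    h.variance_sub_postMean hσ hq i hI (hq i), ← covariance_self (h.memLp_noise i).aemeasurable,
    h.covariance_noise, if_pos rfl]
  ring

lemma integral_innovation {I : Finset (Fin d)}
    (h : IsGaussianFactorModel P D {I} k σ f ε) (hq : ∀ i, q i ∈ D) (i : ℕ) :
    ∫ ω, (designObs {I} f ε q i ω -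
      postMean k {I} σ I i q (fun j => designObs {I} f ε q j ω) (q i)) ∂P = 0 := by
  have hI := Finset.mem_singleton_self I
  have hε : ∫ ω, ε i ω ∂P = 0 := by rw [(h.noise_law i).integral_eq]; simp
  rw [innovation_eq, integral_add' ((h.memLp_sub_postMean hq i hI (hq i)).integrable one_le_two)
    ((h.memLp_noise i).integrable one_le_two), h.integral_sub_postMean hq i hI (hq i), hε, add_zero]

/-- The mutual information between the values of a factor and its noisy outputs, as a sum over the
successive posterior variances. -/
lemma mutualInfo_eq (h : IsGaussianFactorModel P D U k σ f ε) (hσ : 0 < σ)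
    (hq : ∀ i, q i ∈ D) {I : Finset (Fin d)} (hI : I ∈ U) (n : ℕ) :
    mutualInfo P (fun ω (i : Fin n) => f I (I.restrict (q i)) ω)
      (fun ω (i : Fin n) => f I (I.restrict (q i)) ω + ε i ω) =
    ENNReal.ofReal (∑ i ∈ Finset.range n, Real.log (1 + ownPostVar k σ I i q (q i) / σ ^ 2) / 2) := by
  replace h := h.singleton hI
  replace hI := Finset.mem_singleton_self I
  set F : Ω → Fin n → ℝ := fun ω i => f I (I.restrict (q i)) ω with hF
  set e : Ω → Fin n → ℝ := fun ω i => ε i ω with he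
  set T := innovationMatrix k {I} σ I n q with hT
  let V : Fin n → NNReal := fun i => (postVar k {I} σ I i q (q i) + σ ^ 2).toNNReal
  have hσ2 : 0 < σ ^ 2 := by positivity
  have hpv : ∀ i : Fin n, 0 ≤ postVar k {I} σ I i q (q i) := fun i =>
    h.postVar_nonneg hσ hq i hI (hq i)
  have hVco : ∀ i, (V i : ℝ) = postVar k {I} σ I i q (q i) + σ ^ 2 := fun i =>
    Real.coe_toNNReal _ (by linarith [hpv i])
  have hV0 : ∀ i, V i ≠ 0 := fun i => by
    rw [← NNReal.coe_ne_zero, hVco]; linarith [hpv i]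
  have hv0 : (σ ^ 2).toNNReal ≠ 0 := by simpa using hσ.ne'
  have hFe : ∀ ω, F ω + e ω = fun i : Fin n => designObs {I} f ε q i ω := fun ω => by
    ext i; rw [designObs_singleton]; rfl
  have hTV : ∀ ω i, T.mulVec (F ω + e ω) i = designObs {I} f ε q i ω -
      postMean k {I} σ I i q (fun j => designObs {I} f ε q j ω) (q i) := fun ω i => by
    rw [hFe, hT, innovationMatrix_mulVec k {I} σ I q (fun j => designObs {I} f ε q j ω)]
  have hobs : HasGaussianLaw (fun ω => F ω + e ω) P := by
    simp_rw [hFe]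
    exact (h.hasGaussianLaw_factor_designObs hq n hI (hq 0)).snd
  have hinnov : HasGaussianLaw (fun ω i => T.mulVec (F ω + e ω) i) P :=
    hobs.map (LinearMap.toContinuousLinearMap T.mulVecLin)
  have hinnovi : ∀ i : Fin n, HasGaussianLaw (fun ω => designObs {I} f ε q i ω -
      postMean k {I} σ I i q (fun j => designObs {I} f ε q j ω) (q i)) P := fun i => by
    simp_rw [← hTV]; exact hinnov.eval (X := fun i ω => T.mulVec (F ω + e ω) i) i
  -- The `j`-th innovation is a combination of outputs up to `j`, all of them uncorrelated with the
  -- later innovation `i`.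
  have hcov : ∀ i j : Fin n, j < i → cov[fun ω => T.mulVec (F ω + e ω) i,
      fun ω => T.mulVec (F ω + e ω) j; P] = 0 := fun i j hji => by
    have hi : MemLp (fun ω => T.mulVec (F ω + e ω) i) 2 P := by
      simp_rw [hTV]; exact (hinnovi i).memLp_two
    simp_rw [hTV _ j]
    rw [covariance_fun_sub_right hi (h.memLp_designObs hq j) (h.memLp_postMean hq I j (q j))]
    simp only [postMean, Matrix.dotProduct_mulVec]
    rw [covariance_dotProduct_right (Y := fun i : Fin j => designObs {I} f ε q i) hi
      (fun i => h.memLp_designObs hq i)]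
    simp_rw [hTV]
    rw [h.covariance_innovation_designObs hσ hq hji, zero_sub, neg_eq_zero]
    refine Finset.sum_eq_zero fun l _ => ?_
    rw [h.covariance_innovation_designObs hσ hq (l.2.trans hji), mul_zero]
  have hmain := mutualInfo_add_eq_sum_log (P := P) (F := F) (e := e)
    (aemeasurable_pi_lambda _ fun i => (h.memLp_factor hI (hq i)).aemeasurable)
    (h.noise_indep_factors.comp
      (φ := fun (g : ({I} : Finset (Finset (Fin d))) × D → ℝ) (i : Fin n) =>
        g (⟨I, hI⟩, ⟨q i, hq i⟩))
      (ψ := fun (g : ℕ → ℝ) (i : Fin n) => g i)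
      (measurable_pi_lambda _ fun i => measurable_pi_apply _)
      (measurable_pi_lambda _ fun i => measurable_pi_apply _)) hv0
    (fun i => h.noise_law i) (h.noise_indep.precomp Fin.val_injective)
    (det_innovationMatrix k {I} σ I n q) hV0
    (HasGaussianLaw.iIndepFun_of_covariance_eq_zero hinnov fun i j hij => by
      rcases lt_or_gt_of_ne hij with hlt | hlt
      · rw [covariance_comm]; exact hcov j i hlt
      · exact hcov i j hlt)
    (fun i => by
      have := (hinnovi i).map_eq_gaussianReal
      rw [h.integral_innovation hq, h.variance_innovation hσ hq] at this
      refine ⟨?_, ?_⟩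
      · simp_rw [← hT, hTV]; exact (hinnovi i).aemeasurable
      · simp_rw [← hT, hTV]; exact this)
  rw [← Fin.sum_univ_eq_sum_range
    (fun i => Real.log (1 + ownPostVar k σ I i q (q i) / σ ^ 2) / 2) n]
  refine hmain.trans ?_
  congr 1
  refine Finset.sum_congr rfl fun i _ => ?_
  rw [hVco, Real.coe_toNNReal _ hσ2.le, ownPostVar_eq_postVar]
  congr 2
  field_simp
  ring

end IsGaussianFactorModel

end InformationGain

/-! ### Logarithmic growth of the information gain on a finite domain. -/

section VarianceBounds

variable {d : ℕ} {Ω : Type*} [MeasurableSpace Ω] {P : Measure Ω} [IsProbabilityMeasure P]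
  {D : Finset (Fin d → ℝ)} {U : Finset (Finset (Fin d))}
  {k : FactorKernel d} {σ s : ℝ} {f : FactorProcess d Ω} {ε : ℕ → Ω → ℝ} {q : ℕ → Fin d → ℝ}

namespace IsGaussianFactorModel

lemma ownPostVar_nonneg (h : IsGaussianFactorModel P D U k σ f ε) (hσ : 0 < σ)
    (hq : ∀ i, q i ∈ D) (t : ℕ) {I : Finset (Fin d)} (hI : I ∈ U) {z : Fin d → ℝ} (hz : z ∈ D) :
    0 ≤ ownPostVar k σ I t q z := by
  rw [ownPostVar_eq_postVar]
  exact (h.singleton hI).postVar_nonneg hσ hq t (Finset.mem_singleton_self I) hz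

lemma ownPostVar_le_factorCov (h : IsGaussianFactorModel P D U k σ f ε) (hσ : 0 < σ)
    (hq : ∀ i, q i ∈ D) (t : ℕ) {I : Finset (Fin d)} (hI : I ∈ U) {z : Fin d → ℝ} (hz : z ∈ D) :
    ownPostVar k σ I t q z ≤ factorCov k I z z := by
  rw [ownPostVar_eq_postVar, ← h.variance_factor hI hz]
  simpa using (h.singleton hI).postVar_le hσ hq t (Finset.mem_singleton_self I) hz 0

lemma variance_dotProduct_noise (h : IsGaussianFactorModel P D U k σ f ε) {t : ℕ}
    (w : Fin t → ℝ) :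
    Var[fun ω => w ⬝ᵥ fun i : Fin t => ε i ω; P] = (∑ i, w i ^ 2) * σ ^ 2 := by
  have hm : ∀ i : Fin t, MemLp (ε i) 2 P := fun i => h.memLp_noise i
  rw [← covariance_self (memLp_dotProduct hm w).aemeasurable,
    covariance_dotProduct_right (memLp_dotProduct hm w) hm, Finset.sum_mul]
  refine Finset.sum_congr rfl fun i _ => ?_
  rw [covariance_comm, covariance_dotProduct_right (hm i) hm]
  simp [h.covariance_noise, Fin.val_inj]
  ring

/-- After `m` visits of a point, averaging the outputs bounds the posterior variance by `σ² / m`. -/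
lemma ownPostVar_le_div_card (h : IsGaussianFactorModel P D U k σ f ε) (hσ : 0 < σ)
    (hq : ∀ i, q i ∈ D) (t : ℕ) {I : Finset (Fin d)} (hI : I ∈ U) {z : Fin d → ℝ} (hz : z ∈ D)
    (hpos : 0 < ((Finset.range t).filter fun i => q i = z).card) :
    ownPostVar k σ I t q z ≤ σ ^ 2 / ((Finset.range t).filter fun i => q i = z).card := by
  set m := ((Finset.range t).filter fun i => q i = z).card with hm
  have hm0 : (m : ℝ) ≠ 0 := by exact_mod_cast hpos.ne'
  let w : Fin t → ℝ := fun i => if q i = z then (m : ℝ)⁻¹ else 0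
  have hsum : ∀ c : ℝ, ∑ i : Fin t, (if q i = z then c else 0) = m * c := fun c => by
    rw [Fin.sum_univ_eq_sum_range (fun i => if q i = z then c else 0) t, ← Finset.sum_filter,
      Finset.sum_const, nsmul_eq_mul]
  have hw2 : ∑ i, w i ^ 2 = (m : ℝ)⁻¹ := by
    have : ∀ i : Fin t, w i ^ 2 = if q i = z then ((m : ℝ)⁻¹) ^ 2 else 0 := fun i => by
      simp only [w]; split_ifs <;> simp
    simp_rw [this, hsum]
    field_simp
  -- The weights sum to one and sit on visits of `z`, so the factor value cancels and only averaged
  -- noise is left.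
  have hres : (fun ω => f I (I.restrict z) ω - w ⬝ᵥ fun i : Fin t => designObs {I} f ε q i ω) =
      fun ω => (-w) ⬝ᵥ fun i : Fin t => ε i ω := by
    ext ω
    have hterm : ∀ i : Fin t, w i * designObs {I} f ε q i ω =
        (if q i = z then (m : ℝ)⁻¹ * f I (I.restrict z) ω else 0) + w i * ε i ω := fun i => by
      simp only [w, designObs_singleton]
      split_ifs with hi
      · rw [hi]; ring
      · simp
    simp only [dotProduct, Pi.neg_apply, neg_mul, Finset.sum_neg_distrib]
    simp_rw [hterm]
    rw [Finset.sum_add_distrib, hsum]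
    field_simp
    ring
  rw [ownPostVar_eq_postVar]
  refine ((h.singleton hI).postVar_le hσ hq t (Finset.mem_singleton_self I) hz w).trans_eq ?_
  rw [hres, h.variance_dotProduct_noise]
  simp only [Pi.neg_apply, neg_sq, hw2]
  field_simp

/-- The potential of `m` visits of a point. -/
def visitPotential (G : ℝ) (m : ℕ) : ℝ := if m = 0 then 0 else G + Real.log m

lemma visitPotential_le {G : ℝ} (hG : 0 ≤ G) {m n : ℕ} (hmn : m ≤ n) :
    visitPotential G m ≤ G + Real.log n := by
  rw [visitPotential]
  split_ifs with hm
  · exact add_nonneg hG (Real.log_natCast_nonneg n)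
  · have : (0 : ℝ) < m := by exact_mod_cast Nat.pos_of_ne_zero hm
    gcongr

/-- The first visit of an input costs at most `log (1 + s² / σ²)`; a visit after `m` earlier ones
costs at most `log (1 + 1 / m)`, which telescopes to `log` of the number of visits. -/
lemma sum_log_ownPostVar_le_visitPotential (h : IsGaussianFactorModel P D U k σ f ε) (hσ : 0 < σ)
    {I : Finset (Fin d)} (hI : I ∈ U) (hsignal : ∀ z ∈ D, factorCov k I z z ≤ s ^ 2)
    (hq : ∀ i, q i ∈ D) (n : ℕ) :
    ∑ i ∈ Finset.range n, Real.log (1 + ownPostVar k σ I i q (q i) / σ ^ 2) ≤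
      ∑ z ∈ D, visitPotential (Real.log (1 + s ^ 2 / σ ^ 2))
        ((Finset.range n).filter fun i => q i = z).card := by
  set G := Real.log (1 + s ^ 2 / σ ^ 2) with hG
  induction n with
  | zero => simp [visitPotential]
  | succ n ih =>
    have hσ2 : 0 < σ ^ 2 := by positivity
    have hown := h.ownPostVar_nonneg hσ hq n hI (hq n)
    have hle := (h.ownPostVar_le_factorCov hσ hq n hI (hq n)).trans (hsignal _ (hq n))
    -- Only the potential of the input visited at time `n` changes.
    have hstep : ∀ z ∈ D, visitPotential G ((Finset.range (n + 1)).filter fun i => q i = z).card =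
        visitPotential G ((Finset.range n).filter fun i => q i = z).card +
        if q n = z then
          visitPotential G (((Finset.range n).filter fun i => q i = q n).card + 1) -
          visitPotential G ((Finset.range n).filter fun i => q i = q n).card else 0 := by
      intro z _
      rw [Finset.range_add_one, Finset.filter_insert]
      split_ifs with hz
      · rw [Finset.card_insert_of_notMem (by simp), ← hz]; ring
      · ring
    rw [Finset.sum_range_succ, Finset.sum_congr rfl hstep, Finset.sum_add_distrib,
      Finset.sum_ite_eq, if_pos (hq n)]
    refine add_le_add ih ?_
    set m := ((Finset.range n).filter fun i => q i = q n).card with hm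
    rcases Nat.eq_zero_or_pos m with hm0 | hm0
    · simp only [visitPotential, hm0]
      simp only [zero_add, one_ne_zero, if_false, Nat.cast_one, Real.log_one, add_zero, if_true,
        sub_zero, hG]
      gcongr
    · have hmR : (0 : ℝ) < m := by exact_mod_cast hm0
      have hv := h.ownPostVar_le_div_card hσ hq n hI (hq n) hm0
      rw [← hm] at hv
      simp only [visitPotential, hm0.ne', if_false, Nat.succ_ne_zero]
      rw [add_sub_add_left_eq_sub, ← Real.log_div (by positivity) (by positivity)]
      refine Real.log_le_log (by positivity) ?_
      have : ownPostVar k σ I n q (q n) / σ ^ 2 ≤ 1 / m := by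
        rw [div_le_iff₀ hσ2]; exact hv.trans_eq (by ring)
      calc 1 + ownPostVar k σ I n q (q n) / σ ^ 2 ≤ 1 + 1 / m := by gcongr
        _ = ((m + 1 : ℕ) : ℝ) / m := by push_cast; field_simp

lemma sum_log_ownPostVar_le (h : IsGaussianFactorModel P D U k σ f ε) (hσ : 0 < σ)
    {I : Finset (Fin d)} (hI : I ∈ U) (hsignal : ∀ z ∈ D, factorCov k I z z ≤ s ^ 2)
    (hq : ∀ i, q i ∈ D) (n : ℕ) :
    ∑ i ∈ Finset.range n, Real.log (1 + ownPostVar k σ I i q (q i) / σ ^ 2) ≤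
      D.card * (Real.log (1 + s ^ 2 / σ ^ 2) + Real.log n) := by
  refine (h.sum_log_ownPostVar_le_visitPotential hσ hI hsignal hq n).trans ?_
  rw [← nsmul_eq_mul, ← Finset.sum_const]
  refine Finset.sum_le_sum fun z _ => visitPotential_le (Real.log_nonneg ?_) ?_
  · have : 0 ≤ s ^ 2 / σ ^ 2 := by positivity
    linarith
  · exact (Finset.card_filter_le _ _).trans_eq (Finset.card_range n)

lemma maxInfoGain_le (h : IsGaussianFactorModel P D U k σ f ε) (hσ : 0 < σ)
    {I : Finset (Fin d)} (hI : I ∈ U) (hsignal : ∀ z ∈ D, factorCov k I z z ≤ s ^ 2)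
    (hD : D.Nonempty) (n : ℕ) :
    maxInfoGain P D f ε I n ≤
      ENNReal.ofReal (D.card * (Real.log (1 + s ^ 2 / σ ^ 2) + Real.log n) / 2) := by
  obtain ⟨z, hz⟩ := hD
  refine iSup_le fun a => ?_
  have ha : ∀ i : Fin n, (a i).1 = extendDesign a z i := fun i =>
    (extendDesign_of_lt a z i.2).symm
  simp_rw [ha]
  rw [h.mutualInfo_eq hσ (extendDesign_mem a hz) hI n, ← Finset.sum_div]
  refine ENNReal.ofReal_le_ofReal ?_
  gcongr
  exact h.sum_log_ownPostVar_le hσ hI hsignal (extendDesign_mem a hz) n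

lemma maxInfoGain_ne_top (h : IsGaussianFactorModel P D U k σ f ε) (hσ : 0 < σ)
    {I : Finset (Fin d)} (hI : I ∈ U) (hsignal : ∀ z ∈ D, factorCov k I z z ≤ s ^ 2)
    (hD : D.Nonempty) (n : ℕ) : maxInfoGain P D f ε I n ≠ ⊤ :=
  ((h.maxInfoGain_le hσ hI hsignal hD n).trans_lt ENNReal.ofReal_lt_top).ne

lemma totalInfoGain_ne_top (h : IsGaussianFactorModel P D U k σ f ε) (hσ : 0 < σ)
    (hsignal : ∀ I ∈ U, ∀ z ∈ D, factorCov k I z z ≤ s ^ 2) (hD : D.Nonempty) (n : ℕ) :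
    totalInfoGain P D U f ε n ≠ ⊤ :=
  ENNReal.sum_ne_top.2 fun I hI => h.maxInfoGain_ne_top hσ hI (hsignal I hI) hD n

lemma totalInfoGain_toReal (h : IsGaussianFactorModel P D U k σ f ε) (hσ : 0 < σ)
    (hsignal : ∀ I ∈ U, ∀ z ∈ D, factorCov k I z z ≤ s ^ 2) (hD : D.Nonempty) (n : ℕ) :
    (totalInfoGain P D U f ε n).toReal = ∑ I ∈ U, (maxInfoGain P D f ε I n).toReal :=
  ENNReal.toReal_sum fun I hI => h.maxInfoGain_ne_top hσ hI (hsignal I hI) hD n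

lemma totalInfoGain_toReal_le (h : IsGaussianFactorModel P D U k σ f ε) (hσ : 0 < σ)
    (hsignal : ∀ I ∈ U, ∀ z ∈ D, factorCov k I z z ≤ s ^ 2) (hD : D.Nonempty) (n : ℕ) :
    (totalInfoGain P D U f ε n).toReal ≤
      U.card * (D.card * (Real.log (1 + s ^ 2 / σ ^ 2) + Real.log n) / 2) := by
  rw [h.totalInfoGain_toReal hσ hsignal hD, ← nsmul_eq_mul, ← Finset.sum_const]
  refine Finset.sum_le_sum fun I hI => ENNReal.toReal_le_of_le_ofReal ?_
    (h.maxInfoGain_le hσ hI (hsignal I hI) hD n)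
  have h1 : 0 ≤ Real.log (1 + s ^ 2 / σ ^ 2) := by
    refine Real.log_nonneg ?_
    have : 0 ≤ s ^ 2 / σ ^ 2 := by positivity
    linarith
  have h2 := Real.log_natCast_nonneg n
  positivity

/-- Posterior variances depend on the queries but not on the outputs, so for each outcome the
realized queries may be inserted as a fixed design, one of those in the supremum. The 2 undoes the
halved logarithms. -/
lemma sum_log_ownPostVar_le_totalInfoGain (h : IsGaussianFactorModel P D U k σ f ε) (hσ : 0 < σ)
    (hsignal : ∀ I ∈ U, ∀ z ∈ D, factorCov k I z z ≤ s ^ 2) (hD : D.Nonempty)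
    (hq : ∀ i, q i ∈ D) (n : ℕ) :
    ∑ I ∈ U, ∑ i ∈ Finset.range n, Real.log (1 + ownPostVar k σ I i q (q i) / σ ^ 2) ≤
      2 * (totalInfoGain P D U f ε n).toReal := by
  rw [h.totalInfoGain_toReal hσ hsignal hD, Finset.mul_sum]
  refine Finset.sum_le_sum fun I hI => ?_
  have hle : mutualInfo P (fun ω (i : Fin n) => f I (I.restrict (q i)) ω)
      (fun ω (i : Fin n) => f I (I.restrict (q i)) ω + ε i ω) ≤ maxInfoGain P D f ε I n :=
    le_iSup (fun a : Fin n → D => mutualInfo P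
      (fun (ω : Ω) (i : Fin n) => f I (I.restrict (a i).1) ω)
      (fun (ω : Ω) (i : Fin n) => f I (I.restrict (a i).1) ω + ε i ω)) fun i => ⟨q i, hq i⟩
  rw [h.mutualInfo_eq hσ hq hI n, ENNReal.ofReal_le_iff_le_toReal
    (h.maxInfoGain_ne_top hσ hI (hsignal I hI) hD n), ← Finset.sum_div] at hle
  linarith

end IsGaussianFactorModel

end VarianceBounds

/-! ### Regret bound and its sublinearity. -/

section Regret

/-- Concavity of the logarithm, through Bernoulli's inequality `(1 + u) ^ (a / u) ≤ 1 + a`. -/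
lemma le_div_log_mul_log {a u : ℝ} (ha : 0 ≤ a) (hau : a ≤ u) (hu : 0 < u) :
    a ≤ u / Real.log (1 + u) * Real.log (1 + a) := by
  have hlog : 0 < Real.log (1 + u) := Real.log_pos (by linarith)
  have hb : (1 + u) ^ (a / u) ≤ 1 + a := by
    have := rpow_one_add_le_one_add_mul_self (s := u) (p := a / u) (by linarith)
      (by positivity) ((div_le_one hu).2 hau)
    rwa [div_mul_cancel₀ _ hu.ne'] at this
  have hl := Real.log_le_log (by positivity) hb
  rw [Real.log_rpow (by linarith)] at hl
  rw [div_mul_eq_mul_div, le_div_iff₀ hlog]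
  calc a * Real.log (1 + u) = u * (a / u * Real.log (1 + u)) := by field_simp
    _ ≤ _ := by gcongr

variable {d : ℕ} {Ω : Type*} {D : Finset (Fin d → ℝ)} {U : Finset (Finset (Fin d))}
  {k : FactorKernel d} {σ s δ : ℝ} {f : FactorProcess d Ω} {ε : ℕ → Ω → ℝ}
  {x : ℕ → Ω → Fin d → ℝ}

lemma beta_le_beta (hD : D.Nonempty) (hU : U.Nonempty) (hδ : 0 < δ) {t n : ℕ} (htn : t < n) :
    beta D U δ (t + 1) ≤ beta D U δ n := by
  have hD1 : (0 : ℝ) < D.card := by exact_mod_cast hD.card_pos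
  have hU1 : (0 : ℝ) < U.card := by exact_mod_cast hU.card_pos
  have ht1 : (0 : ℝ) < (t + 1 : ℕ) := by exact_mod_cast Nat.succ_pos t
  have htn' : ((t + 1 : ℕ) : ℝ) ≤ n := by exact_mod_cast htn
  have hpi := Real.pi_pos
  unfold beta
  gcongr

/-- The regret of a single query is at most twice the confidence radius. -/
lemma regret_le_of_confidence (hD : D.Nonempty) (halg : IsDecHBO D U k σ δ f ε x) {ω : Ω} (t : ℕ)
    (hconf : ∀ I ∈ U, ∀ z ∈ D, |f I (I.restrict z) ω -
        postMean k U σ I t (fun i => x i ω) (fun i => observation U f ε x i ω) z| ≤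
      √(beta D U δ (t + 1)) * √(postVar k U σ I t (fun i => x i ω) z)) :
    D.sup' hD (fun z => objective U f z ω) - objective U f (x t ω) ω ≤
      2 * √(beta D U δ (t + 1)) * ∑ I ∈ U, √(postVar k U σ I t (fun i => x i ω) (x t ω)) := by
  obtain ⟨z, hz, hsup⟩ := Finset.exists_mem_eq_sup' hD (fun z => objective U f z ω)
  rw [hsup]
  -- Optimism: the optimum lies below its upper bound, which lies below the one at the query, which
  -- exceeds the value there by at most two radii.
  have h1 : objective U f z ω ≤ acquisition k U σ (beta D U δ (t + 1)) t (fun i => x i ω)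
      (fun i => observation U f ε x i ω) z :=
    Finset.sum_le_sum fun I hI => by linarith [(abs_le.1 (hconf I hI z hz)).2]
  have h2 := halg.maximizes t ω z hz
  have h3 : acquisition k U σ (beta D U δ (t + 1)) t (fun i => x i ω)
      (fun i => observation U f ε x i ω) (x t ω) ≤ objective U f (x t ω) ω +
      2 * √(beta D U δ (t + 1)) * ∑ I ∈ U, √(postVar k U σ I t (fun i => x i ω) (x t ω)) := by
    rw [acquisition, objective, Finset.mul_sum, ← Finset.sum_add_distrib]
    exact Finset.sum_le_sum fun I hI => by
      linarith [(abs_le.1 (hconf I hI _ (halg.mem t ω))).1]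
  linarith

lemma cumRegret_nonneg (hD : D.Nonempty) (hx : ∀ t ω, x t ω ∈ D) (n : ℕ) (ω : Ω) :
    0 ≤ cumRegret D hD U f x n ω :=
  Finset.sum_nonneg fun t _ => sub_nonneg.2
    (Finset.le_sup' (fun z => objective U f z ω) (hx t ω))

variable [MeasurableSpace Ω] {P : Measure Ω} [IsProbabilityMeasure P]

lemma sum_postVar_le (h : IsGaussianFactorModel P D U k σ f ε) (hσ : 0 < σ) (hs : 0 < s)
    (hsignal : ∀ I ∈ U, ∀ z ∈ D, factorCov k I z z ≤ s ^ 2) (hD : D.Nonempty)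
    {q : ℕ → Fin d → ℝ} (hq : ∀ i, q i ∈ D) {η : ℕ → ℝ} {L : ℝ} (hη : Antitone η)
    (hL : Tendsto η atTop (𝓝 L)) (hL0 : 0 < L) {n : ℕ}
    (hcomp : ∀ t < n, VarianceComparableAt k U σ q η t) :
    ∑ I ∈ U, ∑ t ∈ Finset.range n, postVar k U σ I t q (q t) ≤
      σ ^ 2 * ((s ^ 2 / σ ^ 2) / Real.log (1 + s ^ 2 / σ ^ 2)) / L *
        (2 * (totalInfoGain P D U f ε n).toReal) := by
  have hσ2 : 0 < σ ^ 2 := by positivity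
  have hu : 0 < s ^ 2 / σ ^ 2 := by positivity
  have hlog : 0 < Real.log (1 + s ^ 2 / σ ^ 2) := Real.log_pos (by linarith)
  refine le_trans ?_ (mul_le_mul_of_nonneg_left
    (h.sum_log_ownPostVar_le_totalInfoGain hσ hsignal hD hq n) (by positivity))
  rw [Finset.mul_sum]
  refine Finset.sum_le_sum fun I hI => ?_
  rw [Finset.mul_sum]
  refine Finset.sum_le_sum fun t ht => ?_
  have hpv := h.postVar_nonneg hσ hq t hI (hq t)
  have hown := h.ownPostVar_nonneg hσ hq t hI (hq t)
  have hle := (h.ownPostVar_le_factorCov hσ hq t hI (hq t)).trans (hsignal I hI _ (hq t))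
  -- A non-increasing function stays above its limit; this is the only use of monotonicity and
  -- convergence.
  have hLη : L ≤ η t := hη.le_of_tendsto hL t
  have h1 : L * postVar k U σ I t q (q t) ≤ ownPostVar k σ I t q (q t) :=
    (mul_le_mul_of_nonneg_right hLη hpv).trans (hcomp t (Finset.mem_range.1 ht) I hI)
  have h2 := le_div_log_mul_log (a := ownPostVar k σ I t q (q t) / σ ^ 2) (by positivity)
    (by gcongr) hu
  rw [div_le_iff₀ hσ2] at h2
  rw [div_mul_eq_mul_div, le_div_iff₀ hL0]
  linarith

/-- The regret bound on the confidence event. -/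
lemma cumRegret_le_regretBound (h : IsGaussianFactorModel P D U k σ f ε) (hσ : 0 < σ) (hs : 0 < s)
    (hδ : 0 < δ) (hδ1 : δ < 1)
    (hsignal : ∀ I ∈ U, ∀ z ∈ D, factorCov k I z z ≤ s ^ 2) (hD : D.Nonempty)
    (halg : IsDecHBO D U k σ δ f ε x) {ω : Ω}
    (hconf : ∀ t, ∀ I ∈ U, ∀ z ∈ D, |f I (I.restrict z) ω -
        postMean k U σ I t (fun i => x i ω) (fun i => observation U f ε x i ω) z| ≤
      √(beta D U δ (t + 1)) * √(postVar k U σ I t (fun i => x i ω) z))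
    {η : ℕ → ℝ} {L : ℝ} (hη : Antitone η) (hL : Tendsto η atTop (𝓝 L)) (hL0 : 0 < L) {n : ℕ}
    (hcomp : ∀ t < n, VarianceComparableAt k U σ (fun i => x i ω) η t) :
    cumRegret D hD U f x n ω ≤ regretBound P D U f ε δ (regretConst U σ s L) n := by
  rcases U.eq_empty_or_nonempty with rfl | hU
  · have h0 : cumRegret D hD ∅ f x n ω = 0 := by simp [cumRegret, objective]
    rw [h0]; exact Real.sqrt_nonneg _
  -- `beta_nonneg` starts at index 1; for `n = 0` both sides vanish.
  rcases Nat.eq_zero_or_pos n with rfl | hn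
  · simp [cumRegret, regretBound]
  have hβ : 0 ≤ beta D U δ n := by
    obtain ⟨m, rfl⟩ := Nat.exists_eq_succ_of_ne_zero hn.ne'
    exact beta_nonneg D U δ hD hU hδ hδ1 m
  set pv : Finset (Fin d) → ℕ → ℝ := fun I t => postVar k U σ I t (fun i => x i ω) (x t ω) with hpv
  have hpv0 : ∀ I ∈ U, ∀ t, 0 ≤ pv I t := fun I hI t =>
    h.postVar_nonneg hσ (fun i => halg.mem i ω) t hI (halg.mem t ω)
  set S := ∑ I ∈ U, ∑ t ∈ Finset.range n, √(pv I t) with hS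
  have hS0 : 0 ≤ S := Finset.sum_nonneg fun I _ => Finset.sum_nonneg fun t _ => Real.sqrt_nonneg _
  have hreg : cumRegret D hD U f x n ω ≤ 2 * √(beta D U δ n) * S := by
    rw [hS, Finset.sum_comm, Finset.mul_sum]
    refine Finset.sum_le_sum fun t ht => ?_
    refine (regret_le_of_confidence hD halg t (hconf t)).trans ?_
    have := beta_le_beta hD hU hδ (Finset.mem_range.1 ht)
    have hnn : 0 ≤ ∑ I ∈ U, √(pv I t) := Finset.sum_nonneg fun I _ => Real.sqrt_nonneg _
    gcongr
  -- Cauchy–Schwarz over all pairs of factor and time at once.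
  have hCS : S ^ 2 ≤ U.card * n * ∑ I ∈ U, ∑ t ∈ Finset.range n, pv I t := by
    have hcs := sq_sum_le_card_mul_sum_sq (s := U ×ˢ Finset.range n) (f := fun p => √(pv p.1 p.2))
    rw [Finset.sum_product, Finset.sum_product, Finset.card_product, Finset.card_range] at hcs
    refine hcs.trans_eq ?_
    push_cast
    congr 1
    exact Finset.sum_congr rfl fun I hI => Finset.sum_congr rfl fun t _ =>
      Real.sq_sqrt (hpv0 I hI t)
  have hsum := sum_postVar_le h hσ hs hsignal hD (fun i => halg.mem i ω) hη hL hL0 hcomp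
  refine Real.le_sqrt_of_sq_le ?_
  have hR0 := cumRegret_nonneg (U := U) (f := f) hD halg.mem n ω
  calc cumRegret D hD U f x n ω ^ 2 ≤ (2 * √(beta D U δ n) * S) ^ 2 := by gcongr
    _ = 4 * beta D U δ n * S ^ 2 := by
        rw [mul_pow, mul_pow, Real.sq_sqrt hβ]; ring
    _ ≤ 4 * beta D U δ n * (U.card * n *
          (σ ^ 2 * ((s ^ 2 / σ ^ 2) / Real.log (1 + s ^ 2 / σ ^ 2)) / L *
        (2 * (totalInfoGain P D U f ε n).toReal))) := by
        gcongr
        exact hCS.trans (by gcongr)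
    _ = _ := by rw [regretConst]; ring

lemma beta_isBigO_log (hD : D.Nonempty) (hU : U.Nonempty) (hδ : 0 < δ) :
    (fun n : ℕ => beta D U δ n) =O[atTop] fun n : ℕ => Real.log n := by
  have hD1 : (0 : ℝ) < D.card := by exact_mod_cast hD.card_pos
  have hU1 : (0 : ℝ) < U.card := by exact_mod_cast hU.card_pos
  have hpi := Real.pi_pos
  have hconst : (fun _ : ℕ => 2 * Real.log (D.card * U.card * (Real.pi ^ 2 / 6) / δ))
      =O[atTop] fun n : ℕ => Real.log n :=
    (Real.isLittleO_const_log_atTop.comp_tendsto tendsto_natCast_atTop_atTop).isBigO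
  refine (hconst.add ((isBigO_refl (fun n : ℕ => Real.log n) atTop).const_mul_left 4)).congr' ?_
    EventuallyEq.rfl
  filter_upwards [eventually_gt_atTop 0] with n hn
  have hn' : (0 : ℝ) < n := by exact_mod_cast hn
  have : (D.card * U.card * (Real.pi ^ 2 * n ^ 2 / 6) / δ : ℝ) =
      (D.card * U.card * (Real.pi ^ 2 / 6) / δ) * n ^ 2 := by ring
  rw [beta, this, Real.log_mul (by positivity) (by positivity), Real.log_pow]
  push_cast
  ring

lemma totalInfoGain_isBigO_log (h : IsGaussianFactorModel P D U k σ f ε) (hσ : 0 < σ)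
    (hsignal : ∀ I ∈ U, ∀ z ∈ D, factorCov k I z z ≤ s ^ 2) (hD : D.Nonempty) :
    (fun n : ℕ => (totalInfoGain P D U f ε n).toReal) =O[atTop] fun n : ℕ => Real.log n := by
  have hconst : (fun _ : ℕ => Real.log (1 + s ^ 2 / σ ^ 2)) =O[atTop] fun n : ℕ => Real.log n :=
    (Real.isLittleO_const_log_atTop.comp_tendsto tendsto_natCast_atTop_atTop).isBigO
  refine IsBigO.trans (IsBigO.of_bound 1 (Eventually.of_forall fun n => ?_))
    ((hconst.add (isBigO_refl (fun n : ℕ => Real.log n) atTop)).const_mul_left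
      (U.card * D.card / 2))
  rw [one_mul, Real.norm_of_nonneg ENNReal.toReal_nonneg]
  exact ((h.totalInfoGain_toReal_le hσ hsignal hD n).trans_eq (by ring)).trans (le_abs_self _)

lemma regretBound_isLittleO (h : IsGaussianFactorModel P D U k σ f ε) (hσ : 0 < σ) (hδ : 0 < δ)
    (hsignal : ∀ I ∈ U, ∀ z ∈ D, factorCov k I z z ≤ s ^ 2) (hD : D.Nonempty) (L : ℝ) :
    (fun n : ℕ => regretBound P D U f ε δ (regretConst U σ s L) n)
      =o[atTop] (fun n : ℕ => (n : ℝ)) := by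
  rcases U.eq_empty_or_nonempty with rfl | hU
  · simp [regretBound, regretConst]
  set C := regretConst U σ s L
  have hO : (fun n : ℕ => C * (beta D U δ n * (totalInfoGain P D U f ε n).toReal))
      =o[atTop] fun n : ℕ => (n : ℝ) := by
    have h1 := ((beta_isBigO_log hD hU hδ).mul
      (totalInfoGain_isBigO_log h hσ hsignal hD)).const_mul_left C
    refine h1.trans_isLittleO ?_
    have h2 := (Real.isLittleO_pow_log_id_atTop (n := 2)).comp_tendsto
      (tendsto_natCast_atTop_atTop (R := ℝ))
    simpa [Function.comp_def, sq] using h2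
  have hsqrt : Tendsto (fun n : ℕ =>
      √(C * (beta D U δ n * (totalInfoGain P D U f ε n).toReal) / n)) atTop (𝓝 0) := by
    have := (Real.continuous_sqrt.tendsto 0).comp hO.tendsto_div_nhds_zero
    rwa [Real.sqrt_zero] at this
  rw [isLittleO_iff_tendsto' (by
    filter_upwards [eventually_gt_atTop 0] with n hn h0
    exact absurd (by exact_mod_cast h0) hn.ne')]
  refine hsqrt.congr' ?_
  filter_upwards [eventually_gt_atTop 0] with n hn
  have hn' : (0 : ℝ) < n := by exact_mod_cast hn
  rw [regretBound]
  -- The third `n` is the denominator on the right; as `√(n ^ 2)` it can move under the root.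
  nth_rewrite 3 [← Real.sqrt_sq hn'.le]
  rw [← Real.sqrt_div' _ (by positivity)]
  congr 1
  field_simp

end Regret

end DecHBO

end

theorem theorem2 {d : ℕ} {Ω : Type*} [MeasurableSpace Ω] (P : Measure Ω) [IsProbabilityMeasure P]
    (D : Finset (Fin d → ℝ)) (hD : D.Nonempty) (U : Finset (Finset (Fin d)))
    (k : DecHBO.FactorKernel d) (f : DecHBO.FactorProcess d Ω) (ε : ℕ → Ω → ℝ)
    (x : ℕ → Ω → Fin d → ℝ)
    (σ s δ : ℝ) (hσ : 0 < σ) (hs : 0 < s) (hδ : 0 < δ) (hδ1 : δ < 1)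
    (hmodel : DecHBO.IsGaussianFactorModel P D U k σ f ε)
    -- `s ^ 2` is the signal variance
    (hsignal : ∀ I ∈ U, ∀ z ∈ D, DecHBO.factorCov k I z z ≤ s ^ 2)
    (halg : DecHBO.IsDecHBO D U k σ δ f ε x) :
    -- the total information gain is finite and the bound is sublinear
    (∀ n, DecHBO.totalInfoGain P D U f ε n ≠ ⊤) ∧
    (∀ L : ℝ, 0 < L →
      (fun n : ℕ => DecHBO.regretBound P D U f ε δ (DecHBO.regretConst U σ s L) n)
        =o[atTop] (fun n : ℕ => (n : ℝ))) ∧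
    -- on an event of probability at least `1 - δ`, whenever the realized queries satisfy the
    -- variance comparison with a decreasing function `h` of positive limit `L`, the cumulative
    -- regret obeys the bound (and hence there is no regret asymptotically)
    ∃ E : Set Ω, MeasurableSet E ∧ ENNReal.ofReal (1 - δ) ≤ P E ∧
      ∀ ω ∈ E, ∀ (h : ℕ → ℝ) (L : ℝ), Antitone h → Tendsto h atTop (𝓝 L) → 0 < L →
        (∀ n : ℕ,
          (∀ t < n, DecHBO.VarianceComparableAt k U σ (fun i => x i ω) h t) →
          DecHBO.cumRegret D hD U f x n ω ≤
            DecHBO.regretBound P D U f ε δ (DecHBO.regretConst U σ s L) n) ∧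
        ((∀ t : ℕ, DecHBO.VarianceComparableAt k U σ (fun i => x i ω) h t) →
          Tendsto (fun n : ℕ => DecHBO.cumRegret D hD U f x n ω / n) atTop (𝓝 0)) := by
  have hlittle := fun L => DecHBO.regretBound_isLittleO hmodel hσ hδ hsignal hD L
  -- The confidence event is fixed before `h` and `L`, so one event serves all comparison functions.
  obtain ⟨E, hE, hPE, hconf⟩ :=
    DecHBO.exists_confidence_event hmodel hσ hD hδ hδ1 halg
  refine ⟨hmodel.totalInfoGain_ne_top hσ hsignal hD, fun L _ => hlittle L,
    E, hE, hPE, fun ω hω h L hh hL hL0 => ?_⟩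
  have hbound : ∀ n : ℕ,
      (∀ t < n, DecHBO.VarianceComparableAt k U σ (fun i => x i ω) h t) →
      DecHBO.cumRegret D hD U f x n ω ≤
        DecHBO.regretBound P D U f ε δ (DecHBO.regretConst U σ s L) n := fun n hcomp =>
    DecHBO.cumRegret_le_regretBound hmodel hσ hs hδ hδ1 hsignal hD halg (hconf ω hω) hh hL hL0 hcomp
  refine ⟨hbound, fun hcomp => ?_⟩
  refine tendsto_of_tendsto_of_tendsto_of_le_of_le tendsto_const_nhds
    (hlittle L).tendsto_div_nhds_zero (fun n => ?_) (fun n => ?_)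
  · exact div_nonneg (DecHBO.cumRegret_nonneg hD halg.mem n ω) n.cast_nonneg
  · exact div_le_div_of_nonneg_right (hbound n fun t _ => hcomp t) n.cast_nonneg
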